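/- Consider a mechanical system with $n$ degrees of freedom given by the Lagrange equations $D(q)\ddot q+C(q,\dot q)\dot q+g(q)=u$, where $D,C,g$ are smooth, $D(q)$ is symmetric and positive definite for every $q$, $g=\nabla U$ for a smooth potential energy $U$, and the Coriolis matrix $C$ is chosen, as usual, such that $\dot D(q)-2C(q,\dot q)$ is skew-symmetric. Assume that $D,C,g$ depend linearly on a vector $\theta\in\mathbb R^m$ of unknown constant parameters; for an estimate $\hat\theta\in\mathbb R^m$ let $\hat D,\hat C,\hat g$ be the functions obtained by replacing $\theta$ with $\hat\theta$, and let $\widetilde\Psi(q,v,w,a)\in\mathbb R^{m\times n}$ be the regressor, defined by $\widetilde\Psi(q,v,w,a)^\top\theta=D(q)a+C(q,v)w+g(q)$ for all $\theta\in\mathbb R^m$. Let $q_d:\mathbb R\to\mathbb R^n$ be a twice continuously differentiable reference trajectory such that $q_d,\dot q_d,\ddot q_d$ are bounded on $\mathbb R$. Let $\lambda,\gamma>0$, let $K_d$ be positive definite, and put $\tilde q=q-q_d$, $\dot q_r=\dot q_d-\lambda\tilde q$, $s=\dot q-\dot q_r$, $\tilde\theta=\hat\theta-\theta$. Close the loop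 with the Slotine–Li controller and the speed-gradient adaptive law $$u=\hat D(q)\ddot q_r+\hat C(q,\dot q)\dot q_r+\hat g(q)-K_ds,\qquad \dot{\hat\theta}=-\gamma\,\widetilde\Psi(q,\dot q,\dot q_r,\ddot q_r)\,s .$$ Write $\dot x=F(t,x)$ for the resulting system in $x=(\tilde\theta,\tilde q,s)$. Its origin is called uniformly globally asymptotically stable (UGAS) if for every $(t_0,x_0)\in\mathbb R\times\mathbb R^{m+2n}$ solutions exist for all $t\ge t_0$, there is $\alpha\in\mathcal K_\infty$ with $|x(t)|\le\alpha(|x(t_0)|)$ for all solutions and all $t\ge t_0$, and for all $r,\sigma>0$ there is $T>0$ such that $|x(t_0)|\le r$ implies $|x(t)|\le\sigma$ for all $t\ge t_0+T$. Let $\Phi(t)=\widetilde\Psi(q_d(t),\dot q_d(t),\dot q_d(t),\ddot q_d(t))$; it is called persistently exciting if there are $T,\mu>0$ with $\int_t^{t+T}\Phi(\tau)\Phi(\tau)^\top d\tau\ge\mu I$ for all $t\in\mathbb R$. (i) If the origin is UGAS, then $\Phi$ is persistently exciting. (ii) Conversely, if $\Phi$ is uniformly continuous (for instance, if $\Phi$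 has a bounded derivative, as is the case when the third derivative of $q_d$ exists and is bounded) and $\Phi$ is persistently exciting, then the origin is UGAS. Thus, for uniformly continuous $\Phi$, the origin is UGAS if and only if $\Phi$ is persistently exciting. -/

import Mathlib

open scoped ContDiff InnerProductSpace Matrix

noncomputable section

/-! ### Uniform global asymptotic stability of `ẋ = F(t, x)` -/

/-- Comparison functions `γ : [0, ∞) → [0, ∞)` of class `𝒦_∞` (only the values on `[0, ∞)` matter). -/
structure IsClassKInfty (γ : ℝ → ℝ) : Prop where
  continuousOn : ContinuousOn γ (Set.Ici 0)
  strictMonoOn : StrictMonoOn γ (Set.Ici 0)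
  map_zero : γ 0 = 0
  tendsto_atTop : Filter.Tendsto γ Filter.atTop Filter.atTop

/-- `x` is a (classical) solution of `ẋ = F(t, x)` on the time interval `I`; derivatives at the
end points of `I` are one-sided. -/
def IsSolutionOn {E : Type*} [NormedAddCommGroup E] [NormedSpace ℝ E]
    (F : ℝ → E → E) (I : Set ℝ) (x : ℝ → E) : Prop :=
  ∀ t ∈ I, HasDerivWithinAt x (F t (x t)) I t

/-- Every initial condition `(t₀, x₀)` has a solution defined for all `t ≥ t₀`. -/
def IsForwardComplete {E : Type*} [NormedAddCommGroup E] [NormedSpace ℝ E]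
    (F : ℝ → E → E) : Prop :=
  ∀ (t₀ : ℝ) (x₀ : E), ∃ x : ℝ → E, x t₀ = x₀ ∧ IsSolutionOn F (Set.Ici t₀) x

/-- Uniform global stability of the origin. The bound is required of every solution on every
interval `[t₀, t]`, hence of every solution for as long as it exists. -/
def IsUGS {E : Type*} [NormedAddCommGroup E] [NormedSpace ℝ E] (F : ℝ → E → E) : Prop :=
  ∃ γ : ℝ → ℝ, IsClassKInfty γ ∧ ∀ (t₀ t : ℝ), t₀ ≤ t →
    ∀ x : ℝ → E, IsSolutionOn F (Set.Icc t₀ t) x → ‖x t‖ ≤ γ ‖x t₀‖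

/-- Uniform global attractivity of the origin. -/
def IsUniformlyGloballyAttractive {E : Type*} [NormedAddCommGroup E] [NormedSpace ℝ E]
    (F : ℝ → E → E) : Prop :=
  ∀ r > 0, ∀ σ > 0, ∃ T > 0, ∀ (t₀ t : ℝ), t₀ + T ≤ t →
    ∀ x : ℝ → E, IsSolutionOn F (Set.Icc t₀ t) x → ‖x t₀‖ ≤ r → ‖x t‖ ≤ σ

/-- Uniform global asymptotic stability of the origin: solutions exist for all future times, and
the origin is uniformly globally stable and uniformly globally attractive. -/
structure IsUGAS {E : Type*} [NormedAddCommGroup E] [NormedSpace ℝ E] (F : ℝ → E → E) : Prop where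
  forwardComplete : IsForwardComplete F
  stable : IsUGS F
  attractive : IsUniformlyGloballyAttractive F

/-! ### Persistency of excitation -/

/-- `Φ : ℝ → ℝ^{m × n}` is persistently exciting: there are `T, μ > 0` with
`∫_t^{t+T} Φ(τ) Φ(τ)ᵀ dτ ≥ μ I` for all `t ∈ ℝ`, in the order of symmetric matrices; the integral
of a matrix is taken entrywise. -/
def IsPersistentlyExciting {m n : ℕ} (Φ : ℝ → Matrix (Fin m) (Fin n) ℝ) : Prop :=
  ∃ T > 0, ∃ μ > 0, ∀ t : ℝ,
    ((Matrix.of fun i j => ∫ τ in t..(t + T), (Φ τ * (Φ τ)ᵀ) i j) -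
      μ • (1 : Matrix (Fin m) (Fin m) ℝ)).PosSemidef

/-! ### Mechanical systems that are linear in the parameters -/

/-- The smooth data of the model `D(q) q̈ + C(q, q̇) q̇ + g(q) = u` with `n` degrees of freedom,
linear in a vector `θ ∈ ℝ^m` of lumped parameters: `D`, `C`, `g` are the linear combinations, with
coefficients `θ₁, …, θ_m`, of the matrices `inertia k q`, `coriolis k (q, v)` and the vectors
`gravity k q`. Matrices are identified with linear operators of Euclidean space. -/
structure MechanicalModel (n m : ℕ) where
  inertia : Fin m → EuclideanSpace ℝ (Fin n) →
    EuclideanSpace ℝ (Fin n) →L[ℝ] EuclideanSpace ℝ (Fin n)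
  coriolis : Fin m → EuclideanSpace ℝ (Fin n) × EuclideanSpace ℝ (Fin n) →
    EuclideanSpace ℝ (Fin n) →L[ℝ] EuclideanSpace ℝ (Fin n)
  gravity : Fin m → EuclideanSpace ℝ (Fin n) → EuclideanSpace ℝ (Fin n)
  inertia_smooth : ∀ k, ContDiff ℝ ∞ (inertia k)
  coriolis_smooth : ∀ k, ContDiff ℝ ∞ (coriolis k)
  gravity_smooth : ∀ k, ContDiff ℝ ∞ (gravity k)

namespace MechanicalModel

variable {n m : ℕ} (M : MechanicalModel n m)

/-- The inertia matrix `D(q) = ∑ₖ θₖ Dₖ(q)` for the parameter value `θ`. -/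
def D (θ : EuclideanSpace ℝ (Fin m)) (q : EuclideanSpace ℝ (Fin n)) :
    EuclideanSpace ℝ (Fin n) →L[ℝ] EuclideanSpace ℝ (Fin n) :=
  Fintype.linearCombination ℝ (fun k => M.inertia k q) θ.ofLp

/-- The Coriolis matrix `C(q, v) = ∑ₖ θₖ Cₖ(q, v)` for the parameter value `θ`. -/
def C (θ : EuclideanSpace ℝ (Fin m)) (q v : EuclideanSpace ℝ (Fin n)) :
    EuclideanSpace ℝ (Fin n) →L[ℝ] EuclideanSpace ℝ (Fin n) :=
  Fintype.linearCombination ℝ (fun k => M.coriolis k (q, v)) θ.ofLp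

/-- The potential force vector `g(q) = ∑ₖ θₖ gₖ(q)` for the parameter value `θ`. -/
def g (θ : EuclideanSpace ℝ (Fin m)) (q : EuclideanSpace ℝ (Fin n)) : EuclideanSpace ℝ (Fin n) :=
  Fintype.linearCombination ℝ (fun k => M.gravity k q) θ.ofLp

/-- The Lagrangian `½ vᵀ D(q) v - U(q)`. -/
def lagrangian (θ : EuclideanSpace ℝ (Fin m)) (U : EuclideanSpace ℝ (Fin n) → ℝ)
    (q v : EuclideanSpace ℝ (Fin n)) : ℝ :=
  1 / 2 * ⟪v, M.D θ q v⟫_ℝ - U q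

/-- For the parameter value `θ` the model is an Euler–Lagrange mechanical system: `D(q)` is
symmetric and positive definite, `D(q) q̈ + C(q, q̇) q̇ + g(q)` is the left-hand side
`d/dt ∂L/∂q̇ - ∂L/∂q` of the Lagrange equations of `L = ½ q̇ᵀ D(q) q̇ - U(q)` for some
potential energy `U`, and the factor `C` of the Coriolis forces is chosen, as usual, such that
`Ḋ - 2 C` is skew-symmetric (the choice by Christoffel symbols is one such). -/
structure IsEulerLagrange (θ : EuclideanSpace ℝ (Fin m)) : Prop where
  symm : ∀ q a b, ⟪M.D θ q a, b⟫_ℝ = ⟪a, M.D θ q b⟫_ℝ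
  posDef : ∀ q a, a ≠ 0 → 0 < ⟪a, M.D θ q a⟫_ℝ
  lagrange : ∃ U : EuclideanSpace ℝ (Fin n) → ℝ, ContDiff ℝ ∞ U ∧
    ∀ q : ℝ → EuclideanSpace ℝ (Fin n), ContDiff ℝ ∞ q → ∀ t : ℝ,
      deriv (fun τ => gradient (fun v => M.lagrangian θ U (q τ) v) (deriv q τ)) t
          - gradient (fun p => M.lagrangian θ U p (deriv q t)) (q t)
        = M.D θ (q t) (deriv (deriv q) t) + M.C θ (q t) (deriv q t) (deriv q t) + M.g θ (q t)
  skew : ∀ q v a, ⟪a, fderiv ℝ (M.D θ) q v a - (2 : ℝ) • M.C θ q v a⟫_ℝ = 0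

/-- The regressor `Ψ̃(q, v, w, a) ∈ ℝ^{m × n}`, characterized by
`Ψ̃(q, v, w, a)ᵀ θ = D(q) a + C(q, v) w + g(q)` for every parameter value `θ`. -/
def regressor (q v w a : EuclideanSpace ℝ (Fin n)) : Matrix (Fin m) (Fin n) ℝ :=
  Matrix.of fun k i => (M.inertia k q a + M.coriolis k (q, v) w + M.gravity k q) i

/-- The acceleration `q̈` of the system `D(q) q̈ + C(q, q̇) q̇ + g(q) = u` at `(q, q̇) = (q, v)`. -/
def acceleration (θ : EuclideanSpace ℝ (Fin m)) (q v u : EuclideanSpace ℝ (Fin n)) :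
    EuclideanSpace ℝ (Fin n) :=
  (M.D θ q).inverse (u - M.C θ q v v - M.g θ q)

/-- The Slotine–Li control law `u = D̂(q) q̈_r + Ĉ(q, q̇) q̇_r + ĝ(q) - K_d s`, where
`s = q̇ - q̇_r`, with `q̇ = v`, `q̇_r = vr`, `q̈_r = ar` and parameter estimate `θhat`. -/
def slotineLiControl (Kd : EuclideanSpace ℝ (Fin n) →L[ℝ] EuclideanSpace ℝ (Fin n))
    (θhat : EuclideanSpace ℝ (Fin m)) (q v vr ar : EuclideanSpace ℝ (Fin n)) :
    EuclideanSpace ℝ (Fin n) :=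
  M.D θhat q ar + M.C θhat q v vr + M.g θhat q - Kd (v - vr)

/-- The speed-gradient adaptive law: the right-hand side `-γ Ψ̃(q, q̇, q̇_r, q̈_r) s` of the
equation for the derivative of the parameter estimate. -/
def speedGradient (γ : ℝ) (q v vr ar : EuclideanSpace ℝ (Fin n)) : EuclideanSpace ℝ (Fin m) :=
  -(γ • WithLp.toLp 2 (M.regressor q v vr ar *ᵥ (v - vr).ofLp))

/-- The closed-loop vector field in the error variables `x = (θ̃, q̃, s)`, where `θ̃ = θ̂ - θ`,
`q̃ = q - q_d`, `q̇_r = q̇_d - λ q̃`, `s = q̇ - q̇_r`. The state `(θ̂, q, q̇)` is recovered from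
`(t, x)`, and the components are `θ̃' = θ̂'`, `q̃' = q̇ - q̇_d` and `s' = q̈ - q̈_r`. -/
def closedLoop (θ : EuclideanSpace ℝ (Fin m))
    (Kd : EuclideanSpace ℝ (Fin n) →L[ℝ] EuclideanSpace ℝ (Fin n)) (lam γ : ℝ)
    (qd : ℝ → EuclideanSpace ℝ (Fin n)) (t : ℝ)
    (x : EuclideanSpace ℝ (Fin m) × EuclideanSpace ℝ (Fin n) × EuclideanSpace ℝ (Fin n)) :
    EuclideanSpace ℝ (Fin m) × EuclideanSpace ℝ (Fin n) × EuclideanSpace ℝ (Fin n) :=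
  let θhat := θ + x.1
  let q := qd t + x.2.1
  let vr := deriv qd t - lam • x.2.1
  let v := vr + x.2.2
  let ar := deriv (deriv qd) t - lam • (v - deriv qd t)
  let u := M.slotineLiControl Kd θhat q v vr ar
  (M.speedGradient γ q v vr ar, v - deriv qd t, M.acceleration θ q v u - ar)

/-- The regressor along the reference, `Φ(t) = Ψ̃(q_d(t), q̇_d(t), q̇_d(t), q̈_d(t))`. -/
def referenceRegressor (qd : ℝ → EuclideanSpace ℝ (Fin n)) (t : ℝ) : Matrix (Fin m) (Fin n) ℝ :=
  M.regressor (qd t) (deriv qd t) (deriv qd t) (deriv (deriv qd) t)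

end MechanicalModel

end

open scoped ContDiff InnerProductSpace Matrix

noncomputable section

/-! ### Solutions: restriction, concatenation, global existence -/

/-! The Lyapunov function is V = ½ sᵀD(q)s + |θ̃|²/(2γ) + c|q̃|². Skew-symmetry of Ḋ − 2C removes
the Coriolis term from its derivative, the adaptive law cancels sᵀΨ̃ᵀθ̃, and for a suitable c what
remains is at most −k|z|² with z = (q̃, s) (`exists_lyapunov_decrease`). This bounds solutions
linearly on every bounded set of initial states (`exists_norm_solution_le`), hence gives uniform
global stability and forward completeness. It does not make θ̃ decay. Excitation enters because at z
= 0 the vector field is (0, 0, D(q_d)⁻¹Φ(t)ᵀθ̃) (`D_closedLoop_param`).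

Necessity: under UGAS a solution starting at (ξ, 0) with |ξ| = 1 has norm at most 1/2 after a
uniform time T, so it has moved by at least 1/2. A Gronwall estimate
(`IsSolutionOn.norm_sub_init_le`) bounds the displacement through the integral of the squared field
frozen at (ξ, 0), and that field is controlled by Φᵀξ. So the integral of |Φᵀξ|² over every window
of length T has a positive lower bound.

Sufficiency: V can drop only finitely often by a fixed amount, so within a uniform time there is a
long window on which z is tiny (`exists_quiet_window`). On it θ̃ is almost constant, while
excitation supplies an instant τ at which D⁻¹Φᵀθ̃ is at least μ|θ̃|. Uniform continuity of Φ keeps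
this push nearly unchanged on an interval of fixed length h, so z would move by about hμ|θ̃|
(`excitation_le_of_quiet`); hence θ̃ was already small at the start of the window. Stability then
keeps the whole state small from there on. -/

/-- `F` is Lipschitz in the state on bounded sets, uniformly in time. -/
def IsLipschitzOnBounded {E : Type*} [NormedAddCommGroup E] (F : ℝ → E → E) : Prop :=
  ∀ R : ℝ, ∃ K : NNReal, ∀ t, LipschitzOnWith K (F t) (Metric.closedBall 0 R)

lemma IsLipschitzOnBounded.exists_norm_sub_le {E : Type*} [NormedAddCommGroup E]
    {F : ℝ → E → E} (hF : IsLipschitzOnBounded F) (R : ℝ) :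
    ∃ K : ℝ, 0 ≤ K ∧ ∀ t, ∀ y y' : E, ‖y‖ ≤ R → ‖y'‖ ≤ R → ‖F t y - F t y'‖ ≤ K * ‖y - y'‖ := by
  obtain ⟨K, hK⟩ := hF R
  refine ⟨K, K.2, fun t y y' hy hy' => ?_⟩
  simpa [dist_eq_norm] using (hK t).dist_le_mul y (by simpa using hy) y' (by simpa using hy')

lemma HasDerivWithinAt.prodFst {P G : Type*} [NormedAddCommGroup P] [NormedSpace ℝ P]
    [NormedAddCommGroup G] [NormedSpace ℝ G] {x : ℝ → P × G} {x' : P × G} {I : Set ℝ} {t : ℝ}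
    (hx : HasDerivWithinAt x x' I t) : HasDerivWithinAt (fun t => (x t).1) x'.1 I t :=
  (ContinuousLinearMap.fst ℝ P G).hasFDerivAt.comp_hasDerivWithinAt t hx

lemma HasDerivWithinAt.prodSnd {P G : Type*} [NormedAddCommGroup P] [NormedSpace ℝ P]
    [NormedAddCommGroup G] [NormedSpace ℝ G] {x : ℝ → P × G} {x' : P × G} {I : Set ℝ} {t : ℝ}
    (hx : HasDerivWithinAt x x' I t) : HasDerivWithinAt (fun t => (x t).2) x'.2 I t :=
  (ContinuousLinearMap.snd ℝ P G).hasFDerivAt.comp_hasDerivWithinAt t hx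

section Solutions

variable {E : Type*} [NormedAddCommGroup E] [NormedSpace ℝ E] {F : ℝ → E → E}

lemma IsSolutionOn.mono {I J : Set ℝ} {x : ℝ → E} (hx : IsSolutionOn F J x) (hIJ : I ⊆ J) :
    IsSolutionOn F I x :=
  fun t ht => (hx t (hIJ ht)).mono hIJ

lemma IsSolutionOn.continuousOn {I : Set ℝ} {x : ℝ → E} (hx : IsSolutionOn F I x) :
    ContinuousOn x I :=
  fun t ht => (hx t ht).continuousWithinAt

lemma IsSolutionOn.concat {a b c : ℝ} (hab : a ≤ b) (hbc : b ≤ c) {x y : ℝ → E}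
    (hx : IsSolutionOn F (Set.Icc a b) x) (hy : IsSolutionOn F (Set.Icc b c) y)
    (hxy : x b = y b) :
    IsSolutionOn F (Set.Icc a c) fun t => if t ≤ b then x t else y t := by
  set z : ℝ → E := fun t => if t ≤ b then x t else y t with hz
  have hzx : ∀ t ∈ Set.Icc a b, z t = x t := fun t ht => if_pos ht.2
  have hzy : ∀ t ∈ Set.Icc b c, z t = y t := by
    intro t ht
    rcases ht.1.eq_or_lt with rfl | h
    · simp [hz, hxy]
    · simp [hz, not_le.2 h]
  have h1 : IsSolutionOn F (Set.Icc a b) z := fun t ht => by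
    rw [hzx t ht]; exact (hx t ht).congr hzx (hzx t ht)
  have h2 : IsSolutionOn F (Set.Icc b c) z := fun t ht => by
    rw [hzy t ht]; exact (hy t ht).congr hzy (hzy t ht)
  intro t ht
  rcases lt_trichotomy t b with h | rfl | h
  · refine (h1 t ⟨ht.1, h.le⟩).mono_of_mem_nhdsWithin ?_
    filter_upwards [self_mem_nhdsWithin, mem_nhdsWithin_of_mem_nhds (Iio_mem_nhds h)] with u hu hu'
    exact ⟨hu.1, le_of_lt hu'⟩
  · rw [← Set.Icc_union_Icc_eq_Icc hab hbc]
    exact (h1 t ⟨hab, le_rfl⟩).union (h2 t ⟨le_rfl, hbc⟩)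
  · refine (h2 t ⟨h.le, ht.2⟩).mono_of_mem_nhdsWithin ?_
    filter_upwards [self_mem_nhdsWithin, mem_nhdsWithin_of_mem_nhds (Ioi_mem_nhds h)] with u hu hu'
    exact ⟨le_of_lt hu', hu.2⟩

/-- On bounded sets of initial states, solutions exist on time intervals of uniform length. -/
lemma IsLipschitzOnBounded.exists_solution_Icc [CompleteSpace E] (hF : IsLipschitzOnBounded F)
    (hc : Continuous (Function.uncurry F)) (h0 : ∀ t, F t 0 = 0) (R : ℝ) :
    ∃ δ > 0, ∀ (t₀ : ℝ) (x₀ : E), ‖x₀‖ ≤ R →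
      ∃ x : ℝ → E, x t₀ = x₀ ∧ IsSolutionOn F (Set.Icc t₀ (t₀ + δ)) x := by
  by_cases hR : 0 ≤ R
  swap
  · exact ⟨1, one_pos, fun _ x₀ h => absurd ((norm_nonneg x₀).trans h) hR⟩
  -- On the ball of radius `R + 1` the field is bounded by `N`, since it vanishes at 0. Within time
  -- 1 / (N + 1) a solution cannot leave the unit ball around `x₀`.
  obtain ⟨K, hK⟩ := hF (R + 1)
  let N : NNReal := K * ⟨R + 1, by linarith⟩
  have hδ : (0 : ℝ) < 1 / (N + 1) := by positivity
  refine ⟨1 / (N + 1), hδ, fun t₀ x₀ hx₀ => ?_⟩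
  have hsub : Metric.closedBall x₀ ((1 : NNReal) : ℝ) ⊆ Metric.closedBall 0 (R + 1) := by
    refine Metric.closedBall_subset_closedBall' ?_
    simp only [NNReal.coe_one, dist_zero_right]
    linarith
  have hPL : IsPicardLindelof F (tmin := t₀) (tmax := t₀ + 1 / (N + 1))
      ⟨t₀, le_rfl, by linarith⟩ x₀ 1 0 N K := by
    refine ⟨fun t _ => (hK t).mono hsub, fun x _ =>
      (hc.comp (continuous_id.prodMk continuous_const)).continuousOn, fun t _ x hx => ?_, ?_⟩
    · have h := (hK t).dist_le_mul x (hsub hx) 0 (Metric.mem_closedBall_self (by linarith))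
      rw [h0, dist_zero_right, dist_zero_right] at h
      refine h.trans ?_
      have hx' : ‖x‖ ≤ R + 1 := by simpa using hsub hx
      exact mul_le_mul_of_nonneg_left hx' K.2
    · simp only [add_sub_cancel_left, sub_self, NNReal.coe_one, NNReal.coe_zero, sub_zero]
      rw [max_eq_left hδ.le, mul_one_div]
      exact div_le_one_of_le₀ (by linarith) (by positivity)
  exact hPL.exists_eq_forall_mem_Icc_hasDerivWithinAt₀

/-- Uniform global stability excludes finite escape times. -/
lemma IsUGS.isForwardComplete [CompleteSpace E] (hS : IsUGS F) (hF : IsLipschitzOnBounded F)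
    (hc : Continuous (Function.uncurry F)) (h0 : ∀ t, F t 0 = 0) : IsForwardComplete F := by
  intro t₀ x₀
  obtain ⟨γ, -, hγ⟩ := hS
  -- The stability bound confines all continuations to one ball, so a single step length `δ` serves
  -- for every extension.
  obtain ⟨δ, hδ, hloc⟩ := hF.exists_solution_Icc hc h0 (γ ‖x₀‖)
  let P : ℕ → (ℝ → E) → Prop :=
    fun k x => x t₀ = x₀ ∧ IsSolutionOn F (Set.Icc t₀ (t₀ + k * δ)) x
  have hstep : ∀ k x, ∃ y, P k x → P (k + 1) y ∧ ∀ t ≤ t₀ + k * δ, y t = x t := by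
    intro k x
    by_cases hP : P k x
    swap
    · exact ⟨x, fun h => absurd h hP⟩
    have hk : 0 ≤ (k : ℝ) * δ := by positivity
    have hb : ‖x (t₀ + k * δ)‖ ≤ γ ‖x₀‖ := by
      rw [← hP.1]; exact hγ _ _ (by linarith) x hP.2
    obtain ⟨y, hy0, hy⟩ := hloc _ _ hb
    refine ⟨fun t => if t ≤ t₀ + k * δ then x t else y t, fun _ => ⟨⟨?_, ?_⟩, fun t ht => ?_⟩⟩
    · simp [hk, hP.1]
    · have := hP.2.concat (by linarith) (by linarith) hy hy0.symm
      convert this using 2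
      push_cast; ring
    · simp [ht]
  choose step hstep using hstep
  let X : ℕ → ℝ → E := fun k => Nat.rec (fun _ => x₀) step k
  have hX : ∀ k, P k (X k) := by
    intro k
    induction k with
    | zero =>
      refine ⟨rfl, fun t ht => ?_⟩
      have : Set.Icc t₀ (t₀ + (0 : ℕ) * δ) = {t₀} := by simp
      rw [this] at ht ⊢
      rw [Set.mem_singleton_iff.1 ht]
      exact HasFDerivWithinAt.of_subsingleton Set.subsingleton_singleton
    | succ k ih => exact (hstep k (X k) ih).1
  have hmono : ∀ i j : ℕ, i ≤ j → ∀ t ≤ t₀ + i * δ, X j t = X i t := by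
    intro i j hij
    induction j, hij using Nat.le_induction with
    | base => exact fun _ _ => rfl
    | succ j hij ih =>
      intro t ht
      rw [← ih t ht]
      refine (hstep j (X j) (hX j)).2 t (ht.trans ?_)
      have : (i : ℝ) ≤ j := by exact_mod_cast hij
      nlinarith
  have hagree : ∀ (i j : ℕ) (t : ℝ), t ≤ t₀ + i * δ → t ≤ t₀ + j * δ → X i t = X j t := by
    intro i j t hi hj
    rcases le_total i j with h | h
    · exact (hmono i j h t hi).symm
    · exact hmono j i h t hj
  -- The added 1 makes `hN` strict, so that the piece `X (N t)` covers a right neighbourhood of `t`.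
  let N : ℝ → ℕ := fun t => ⌈(t - t₀) / δ⌉₊ + 1
  have hN : ∀ t, t < t₀ + N t * δ := by
    intro t
    have h := Nat.le_ceil ((t - t₀) / δ)
    rw [div_le_iff₀ hδ] at h
    simp only [N]; push_cast
    nlinarith
  refine ⟨fun t => X (N t) t, (hX (N t₀)).1, fun t ht => ?_⟩
  have ht' : t ∈ Set.Icc t₀ (t₀ + N t * δ) := ⟨ht, (hN t).le⟩
  have h1 := ((hX (N t)).2 t ht').congr (f₁ := fun t => X (N t) t)
    (fun u hu => hagree _ _ _ (hN u).le hu.2) rfl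
  refine h1.mono_of_mem_nhdsWithin ?_
  filter_upwards [self_mem_nhdsWithin, mem_nhdsWithin_of_mem_nhds (Iio_mem_nhds (hN t))]
    with u hu hu'
  exact ⟨hu, le_of_lt hu'⟩

/-- Linear bounds on the solutions that start in a given ball give a bound of class `𝒦_∞`. -/
lemma IsUGS.of_linear_bounds
    (h : ∀ R : ℝ, ∃ A : ℝ, ∀ t₀ t : ℝ, t₀ ≤ t → ∀ x : ℝ → E,
      IsSolutionOn F (Set.Icc t₀ t) x → ‖x t₀‖ ≤ R → ‖x t‖ ≤ A * ‖x t₀‖) : IsUGS F := by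
  choose A hA using fun k : ℕ => h k
  -- A monotone majorant of the constants `A`, which need not be monotone or nonnegative.
  let B : ℝ → ℝ := fun r => ∑ k ∈ Finset.range (⌈r⌉₊ + 1), |A k|
  have hB : Monotone B := by
    intro r r' hr
    refine Finset.sum_le_sum_of_subset_of_nonneg ?_ fun _ _ _ => abs_nonneg _
    exact Finset.range_mono (Nat.add_le_add_right (Nat.ceil_mono hr) 1)
  have hint : ∀ a b, IntervalIntegrable B MeasureTheory.volume a b :=
    fun a b => hB.intervalIntegrable
  -- Averaging the step function `B` over [r, r + 1] makes it continuous, keeps it monotone and does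
  -- not decrease it.
  let I : ℝ → ℝ := fun r => ∫ τ in (0 : ℝ)..1, B (r + τ)
  have hIB : ∀ r, B r ≤ I r := by
    intro r
    have : ∫ τ in (0 : ℝ)..1, B r ≤ I r := by
      refine intervalIntegral.integral_mono_on zero_le_one (by simp) ?_ ?_
      · exact (hB.comp (add_right_mono (a := r))).intervalIntegrable
      · exact fun τ hτ => hB (by linarith [hτ.1])
    simpa using this
  have hImono : Monotone I := by
    intro r r' hr
    refine intervalIntegral.integral_mono_on zero_le_one ?_ ?_ fun τ _ => hB (by linarith)
    all_goals
      exact (hB.comp add_right_mono).intervalIntegrable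
  have hIcont : Continuous I := by
    have : I = fun r => (∫ τ in (0 : ℝ)..(r + 1), B τ) - ∫ τ in (0 : ℝ)..r, B τ := by
      funext r
      simp only [I]
      rw [intervalIntegral.integral_comp_add_left, intervalIntegral.integral_interval_sub_left]
      · simp
      · exact hint _ _
      · exact hint _ _
    rw [this]
    have hp := intervalIntegral.continuous_primitive hint 0
    exact (hp.comp (continuous_id.add continuous_const)).sub hp
  have hB0 : ∀ r, 0 ≤ B r := fun r => Finset.sum_nonneg fun _ _ => abs_nonneg _
  have hI0 : ∀ r, 0 ≤ I r := fun r => (hB0 r).trans (hIB r)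
  refine ⟨fun r => r * (1 + I r), ⟨?_, ?_, by simp, ?_⟩, ?_⟩
  · exact (continuous_id.mul (continuous_const.add hIcont)).continuousOn
  · intro r hr r' _ hlt
    have hr0 : 0 ≤ r := hr
    have h1 := hImono hlt.le
    have h2 := hI0 r
    calc r * (1 + I r) ≤ r * (1 + I r') := by gcongr
      _ < r' * (1 + I r') := mul_lt_mul_of_pos_right hlt (by linarith)
  · refine Filter.tendsto_atTop_mono' _ ?_ Filter.tendsto_id
    filter_upwards [Filter.eventually_ge_atTop 0] with r hr
    have := mul_nonneg hr (hI0 r)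
    simp only [id]; linarith
  · intro t₀ t ht x hx
    have h1 := hA ⌈‖x t₀‖⌉₊ t₀ t ht x hx (Nat.le_ceil _)
    have h2 : A ⌈‖x t₀‖⌉₊ ≤ B ‖x t₀‖ :=
      (le_abs_self _).trans (Finset.single_le_sum (f := fun k => |A k|) (fun _ _ => abs_nonneg _)
        (Finset.self_mem_range_succ _))
    have h3 := hIB ‖x t₀‖
    calc ‖x t‖ ≤ ‖x t₀‖ * A ⌈‖x t₀‖⌉₊ := by rw [mul_comm]; exact h1
      _ ≤ ‖x t₀‖ * (1 + I ‖x t₀‖) := by gcongr; linarith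

/-- A quantitative comparison of a solution with its initial value. -/
lemma IsSolutionOn.norm_sub_init_le (hc : Continuous (Function.uncurry F)) {a b K ε : ℝ}
    (hab : a ≤ b) (hK0 : 0 ≤ K) (hε : 0 < ε) {x : ℝ → E} (hx : IsSolutionOn F (Set.Icc a b) x)
    (hK : ∀ t ∈ Set.Icc a b, ‖F t (x t) - F t (x a)‖ ≤ K * ‖x t - x a‖) :
    ‖x b - x a‖ ≤ Real.exp (K * (b - a)) *
      (ε * (b - a) + ε⁻¹ * ∫ τ in a..b, ‖F τ (x a)‖ ^ 2) := by
  have hcF : Continuous fun τ => ‖F τ (x a)‖ ^ 2 :=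
    ((hc.comp (continuous_id.prodMk continuous_const)).norm).pow 2
  -- The comparison function is exp(K(t − a)) J(t). The square in `J` matches the quadratic form of
  -- persistency of excitation; the weight `ε` is left free for the application.
  let J : ℝ → ℝ := fun t => ε * (t - a) + ε⁻¹ * ∫ τ in a..t, ‖F τ (x a)‖ ^ 2
  have hJ : ∀ t, HasDerivAt J (ε + ε⁻¹ * ‖F t (x a)‖ ^ 2) t := by
    intro t
    have h1 : HasDerivAt (fun t => ε * (t - a)) ε t := by
      simpa using ((hasDerivAt_id t).sub_const a).const_mul ε
    exact h1.add ((intervalIntegral.integral_hasDerivAt_right (hcF.intervalIntegrable _ _)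
      (hcF.stronglyMeasurableAtFilter _ _) hcF.continuousAt).const_mul ε⁻¹)
  have hexp : ∀ t, HasDerivAt (fun t => Real.exp (K * (t - a))) (Real.exp (K * (t - a)) * K) t := by
    intro t
    have h1 : HasDerivAt (fun t => K * (t - a)) K t := by
      simpa using ((hasDerivAt_id t).sub_const a).const_mul K
    exact h1.exp
  have hB : ∀ t, HasDerivAt (fun t => Real.exp (K * (t - a)) * J t)
      (Real.exp (K * (t - a)) * K * J t + Real.exp (K * (t - a)) * (ε + ε⁻¹ * ‖F t (x a)‖ ^ 2)) t :=
    fun t => (hexp t).mul (hJ t)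
  refine image_norm_le_of_norm_deriv_right_lt_deriv_boundary (f := fun t => x t - x a)
    (f' := fun t => F t (x t)) (a := a) (b := b) ?_ ?_ ?_ hB ?_ ⟨hab, le_rfl⟩
  · exact hx.continuousOn.sub continuousOn_const
  · intro t ht
    refine ((hx t ⟨ht.1, ht.2.le⟩).mono_of_mem_nhdsWithin ?_).sub_const _
    exact Icc_mem_nhdsGE_of_mem ht
  · simp [J]
  · intro t ht heq
    have h1 := hK t ⟨ht.1, ht.2.le⟩
    have h2 : ‖F t (x t)‖ ≤ ‖F t (x t) - F t (x a)‖ + ‖F t (x a)‖ := by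
      simpa using norm_add_le (F t (x t) - F t (x a)) (F t (x a))
    rw [heq] at h1
    set n := ‖F t (x a)‖
    -- Young's inequality, strict as the comparison lemma requires at a point of contact.
    have h3 : n < ε + ε⁻¹ * n ^ 2 := by
      have : 0 < ε⁻¹ * ((n - ε / 2) ^ 2 + 3 / 4 * ε ^ 2) := by positivity
      have h : ε⁻¹ * ((n - ε / 2) ^ 2 + 3 / 4 * ε ^ 2) = ε + ε⁻¹ * n ^ 2 - n := by
        field_simp; ring
      linarith
    have h4 : 1 ≤ Real.exp (K * (t - a)) :=
      Real.one_le_exp (mul_nonneg hK0 (sub_nonneg.2 ht.1))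
    have h5 : 0 ≤ ε + ε⁻¹ * n ^ 2 := by positivity
    nlinarith

end Solutions

/-! ### Attractivity from a Lyapunov function and excitation -/

section Attractivity

/-- If `z` is larger than `η` somewhere in `[a, b]`, then `V` drops by a fixed amount until
`b + δ`. -/
lemma lyapunov_drop_of_large {G : Type*} [NormedAddCommGroup G] {z : ℝ → G} {V V' : ℝ → ℝ}
    {a b δ η k L : ℝ} (hδ : 0 < δ) (hη : 0 < η) (hk : 0 < k) (hL : L * δ ≤ η / 2)
    (hV : ∀ t ∈ Set.Icc a (b + δ), HasDerivWithinAt V (V' t) (Set.Icc a (b + δ)) t)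
    (hV' : ∀ t ∈ Set.Icc a (b + δ), V' t ≤ -k * ‖z t‖ ^ 2)
    (hz : ∀ t ∈ Set.Icc a (b + δ), ∀ t' ∈ Set.Icc a (b + δ), t ≤ t' →
      ‖z t' - z t‖ ≤ L * (t' - t))
    (hL0 : 0 ≤ L) {t : ℝ} (ht : t ∈ Set.Icc a b) (hlarge : η < ‖z t‖) :
    V (b + δ) ≤ V a - k * (η / 2) ^ 2 * δ := by
  have hmono : ∀ c d C, a ≤ c → c ≤ d → d ≤ b + δ → (∀ u ∈ Set.Icc c d, V' u ≤ C) →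
      V d - V c ≤ C * (d - c) := by
    intro c d C hac hcd hdb hC
    have hsub : Set.Icc c d ⊆ Set.Icc a (b + δ) := Set.Icc_subset_Icc hac hdb
    refine (convex_Icc c d).image_sub_le_mul_sub_of_deriv_le
      (fun u hu => ((hV u (hsub hu)).mono hsub).continuousWithinAt) ?_ ?_ c
      (Set.left_mem_Icc.2 hcd) d (Set.right_mem_Icc.2 hcd) hcd
    · intro u hu
      have := (hV u (hsub (interior_subset hu))).mono hsub
      exact (this.hasDerivAt (mem_interior_iff_mem_nhds.1 hu)).differentiableAt.differentiableWithinAt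
    · intro u hu
      have := (hV u (hsub (interior_subset hu))).mono hsub
      rw [(this.hasDerivAt (mem_interior_iff_mem_nhds.1 hu)).deriv]
      exact hC u (interior_subset hu)
  have hneg : ∀ u ∈ Set.Icc a (b + δ), V' u ≤ 0 := fun u hu =>
    (hV' u hu).trans (by nlinarith [sq_nonneg ‖z u‖])
  have h1 := hmono a t 0 le_rfl ht.1 (by linarith [ht.2])
    fun u hu => hneg u ⟨hu.1, by linarith [hu.2, ht.2]⟩
  have h3 := hmono (t + δ) (b + δ) 0 (by linarith [ht.1]) (by linarith [ht.2]) le_rfl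
    fun u hu => hneg u ⟨by linarith [hu.1, ht.1], hu.2⟩
  -- By the Lipschitz bound, `z` cannot fall below η / 2 before time t + δ, so `V` decreases at a
  -- fixed rate there; elsewhere it does not increase.
  have h2 := hmono t (t + δ) (-k * (η / 2) ^ 2) ht.1 (by linarith) (by linarith [ht.2]) (by
    intro u hu
    have hu' : u ∈ Set.Icc a (b + δ) := ⟨ht.1.trans hu.1, by linarith [hu.2, ht.2]⟩
    have hd := hz t ⟨ht.1, by linarith [ht.2]⟩ u hu' hu.1
    have hd2 : L * (u - t) ≤ L * δ := mul_le_mul_of_nonneg_left (by linarith [hu.2]) hL0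
    have hd3 : ‖z t‖ ≤ ‖z u‖ + ‖z u - z t‖ := by
      have := norm_sub_norm_le (z t) (z u)
      rw [norm_sub_rev] at this
      linarith
    have hge : η / 2 ≤ ‖z u‖ := by linarith
    have hsq : (η / 2) ^ 2 ≤ ‖z u‖ ^ 2 := by gcongr
    refine (hV' u hu').trans ?_
    nlinarith)
  linarith

/-- A signal that feeds a Lyapunov function stays small on some interval of given length. -/
lemma exists_quiet_window {G : Type*} [NormedAddCommGroup G] {ℓ η k L W : ℝ}
    (hℓ : 0 < ℓ) (hη : 0 < η) (hk : 0 < k) (hL : 0 ≤ L) :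
    ∃ T > 0, ∀ (t₀ : ℝ) (z : ℝ → G) (V V' : ℝ → ℝ),
      (∀ t ∈ Set.Icc t₀ (t₀ + T), HasDerivWithinAt V (V' t) (Set.Icc t₀ (t₀ + T)) t) →
      (∀ t ∈ Set.Icc t₀ (t₀ + T), V' t ≤ -k * ‖z t‖ ^ 2) →
      (∀ t ∈ Set.Icc t₀ (t₀ + T), ∀ t' ∈ Set.Icc t₀ (t₀ + T), t ≤ t' →
        ‖z t' - z t‖ ≤ L * (t' - t)) →
      (∀ t ∈ Set.Icc t₀ (t₀ + T), 0 ≤ V t) → V t₀ ≤ W →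
      ∃ a, t₀ ≤ a ∧ a + ℓ ≤ t₀ + T ∧ ∀ t ∈ Set.Icc a (a + ℓ), ‖z t‖ ≤ η := by
  -- The 1 added to `L` covers `L = 0`.
  set δ := η / (2 * (L + 1)) with hδdef
  have hδ : 0 < δ := by positivity
  have hLδ : L * δ ≤ η / 2 := by
    rw [hδdef, mul_div_assoc', div_le_div_iff₀ (by positivity) two_pos]
    nlinarith
  set κ := k * (η / 2) ^ 2 * δ with hκ
  have hκ0 : 0 < κ := by positivity
  -- `N` drops by `κ` would take `V` from at most `W` below 0. The time below uses N + 1 blocks so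
  -- that it is positive even for `N = 0`.
  obtain ⟨N, hN⟩ := exists_nat_gt (W / κ)
  rw [div_lt_iff₀ hκ0] at hN
  refine ⟨(N + 1) * (ℓ + δ), by positivity, fun t₀ z V V' hV hV' hz hV0 hW => ?_⟩
  by_contra! hno
  have hdrop : ∀ i : ℕ, i ≤ N → V (t₀ + i * (ℓ + δ)) ≤ W - i * κ := by
    intro i
    induction i with
    | zero => intro _; simpa using hW
    | succ i ih =>
      intro hi
      have hi1 : (i : ℝ) + 1 ≤ N := by exact_mod_cast hi
      have h1 := ih (by omega)
      have hpos : 0 ≤ (i : ℝ) * (ℓ + δ) := by positivity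
      have hle : t₀ + i * (ℓ + δ) + ℓ + δ ≤ t₀ + (N + 1) * (ℓ + δ) := by
        nlinarith
      obtain ⟨t, ht, hlarge⟩ := hno (t₀ + i * (ℓ + δ)) (by linarith) (by linarith)
      have hsub : Set.Icc (t₀ + i * (ℓ + δ)) (t₀ + i * (ℓ + δ) + ℓ + δ) ⊆
          Set.Icc t₀ (t₀ + (N + 1) * (ℓ + δ)) := Set.Icc_subset_Icc (by linarith) hle
      have h2 := lyapunov_drop_of_large hδ hη hk hLδ (fun u hu => (hV u (hsub hu)).mono hsub)
        (fun u hu => hV' u (hsub hu)) (fun u hu u' hu' => hz u (hsub hu) u' (hsub hu')) hL ht hlarge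
      have h3 : t₀ + ((i + 1 : ℕ) : ℝ) * (ℓ + δ) = t₀ + i * (ℓ + δ) + ℓ + δ := by push_cast; ring
      rw [h3]; push_cast; linarith
  have h1 := hdrop N le_rfl
  have h2 := hV0 (t₀ + N * (ℓ + δ)) ⟨by linarith [show 0 ≤ (N : ℝ) * (ℓ + δ) by positivity],
    by nlinarith⟩
  linarith

variable {P G : Type*} [NormedAddCommGroup P] [NormedSpace ℝ P] [NormedAddCommGroup G]
  [NormedSpace ℝ G] {F : ℝ → P × G → P × G}

/-- While `z = x.2` is small, the parameter part of the state is nearly constant, so that `z`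
integrates the excitation `F τ (ξ, 0)`, which has to be small as well. -/
lemma excitation_le_of_quiet {K R a ℓ h η ν τ : ℝ} {x : ℝ → P × G}
    (hK0 : 0 ≤ K) (hh : 0 < h)
    (hx : IsSolutionOn F (Set.Icc a (a + ℓ)) x)
    (hR : ∀ t ∈ Set.Icc a (a + ℓ), ‖x t‖ ≤ R)
    (hK : ∀ t, ∀ y y' : P × G, ‖y‖ ≤ R → ‖y'‖ ≤ R → ‖F t y - F t y'‖ ≤ K * ‖y - y'‖)
    (h1 : ∀ t ξ, (F t (ξ, 0)).1 = 0)
    (hν : ∀ t ξ, |t - τ| ≤ h → ‖ξ‖ ≤ R → ‖F t (ξ, 0) - F τ (ξ, 0)‖ ≤ ν)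
    (hquiet : ∀ t ∈ Set.Icc a (a + ℓ), ‖(x t).2‖ ≤ η)
    (hτa : a ≤ τ) (hτh : τ + h ≤ a + ℓ) :
    h * ‖F τ ((x a).1, 0)‖ ≤ 2 * η + h * (K * η * (1 + K * ℓ) + ν) := by
  set ξ := (x a).1 with hξ
  have hℓ : 0 ≤ ℓ := by linarith
  have haI : a ∈ Set.Icc a (a + ℓ) := ⟨le_rfl, by linarith⟩
  have hη : 0 ≤ η := (norm_nonneg _).trans (hquiet a haI)
  have hfst : ∀ t ∈ Set.Icc a (a + ℓ), ‖((x t).1, (0 : G))‖ ≤ R := by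
    intro t ht
    have : ‖((x t).1, (0 : G))‖ = ‖(x t).1‖ := by simp [Prod.norm_def]
    rw [this]; exact (norm_fst_le _).trans (hR t ht)
  have hdiff : ∀ t ∈ Set.Icc a (a + ℓ), ‖F t (x t) - F t ((x t).1, 0)‖ ≤ K * η := by
    intro t ht
    refine (hK t _ _ (hR t ht) (hfst t ht)).trans (mul_le_mul_of_nonneg_left ?_ hK0)
    have : x t - ((x t).1, 0) = (0, (x t).2) := by ext <;> simp
    rw [this]
    simpa [Prod.norm_def] using hquiet t ht
  have hd1 : ∀ t ∈ Set.Icc a (a + ℓ), HasDerivWithinAt (fun t => (x t).1) (F t (x t)).1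
      (Set.Icc a (a + ℓ)) t := fun t ht => (hx t ht).prodFst
  have hd2 : ∀ t ∈ Set.Icc a (a + ℓ), HasDerivWithinAt (fun t => (x t).2) (F t (x t)).2
      (Set.Icc a (a + ℓ)) t := fun t ht => (hx t ht).prodSnd
  have hpar : ∀ t ∈ Set.Icc a (a + ℓ), ‖(x t).1 - ξ‖ ≤ K * η * ℓ := by
    intro t ht
    have h := (convex_Icc a (a + ℓ)).norm_image_sub_le_of_norm_hasDerivWithin_le hd1
      (C := K * η) (fun u hu => ?_) haI ht
    · refine h.trans (mul_le_mul_of_nonneg_left ?_ (by positivity))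
      rw [Real.norm_eq_abs, abs_of_nonneg (by linarith [ht.1])]
      linarith [ht.2]
    · have h2 := (norm_fst_le _).trans (hdiff u hu)
      simpa [h1] using h2
  have hsub : Set.Icc τ (τ + h) ⊆ Set.Icc a (a + ℓ) := Set.Icc_subset_Icc hτa hτh
  -- Compares `z` with linear motion at the velocity frozen at τ and ξ. The velocity error has three
  -- parts: Kη from dropping `z`, K · Kηℓ from the drift of the parameter, and ν from the shift in
  -- time.
  have hmain := (convex_Icc τ (τ + h)).norm_image_sub_le_of_norm_hasDerivWithin_le
    (f := fun t => (x t).2 - (t - τ) • (F τ (ξ, 0)).2)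
    (f' := fun t => (F t (x t)).2 - (F τ (ξ, 0)).2)
    (C := K * η * (1 + K * ℓ) + ν) (x := τ) (y := τ + h) ?_ ?_
    ⟨le_rfl, by linarith⟩ ⟨by linarith, le_rfl⟩
  · have hn : ‖F τ (ξ, 0)‖ = ‖(F τ (ξ, 0)).2‖ := by
      rw [Prod.norm_def, h1]; simp
    have e1 : h • (F τ (ξ, 0)).2 = (x (τ + h)).2 - (x τ).2 -
        (((x (τ + h)).2 - (τ + h - τ) • (F τ (ξ, 0)).2) -
          ((x τ).2 - (τ - τ) • (F τ (ξ, 0)).2)) := by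
      simp only [add_sub_cancel_left, sub_self, zero_smul]; abel
    have e2 : h * ‖F τ (ξ, 0)‖ = ‖h • (F τ (ξ, 0)).2‖ := by
      rw [norm_smul, Real.norm_eq_abs, abs_of_pos hh, hn]
    rw [e2, e1]
    refine (norm_sub_le _ _).trans ?_
    have h3 := norm_sub_le (x (τ + h)).2 (x τ).2
    have h4 := hquiet (τ + h) (hsub ⟨by linarith, le_rfl⟩)
    have h5 := hquiet τ (hsub ⟨le_rfl, by linarith⟩)
    rw [add_sub_cancel_left, Real.norm_eq_abs, abs_of_pos hh] at hmain
    rw [add_sub_cancel_left]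
    linarith
  · intro t ht
    have h2 : HasDerivWithinAt (fun t => (t - τ) • (F τ (ξ, 0)).2) (F τ (ξ, 0)).2
        (Set.Icc τ (τ + h)) t := by
      simpa using (((hasDerivAt_id t).sub_const τ).smul_const (F τ (ξ, 0)).2).hasDerivWithinAt
    exact ((hd2 t (hsub ht)).mono hsub).sub h2
  · intro t ht
    have e : F t (x t) - F τ (ξ, 0) = (F t (x t) - F t ((x t).1, 0)) +
        (F t ((x t).1, 0) - F t (ξ, 0)) + (F t (ξ, 0) - F τ (ξ, 0)) := by abel
    have g1 := hdiff t (hsub ht)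
    have g2 : ‖F t ((x t).1, 0) - F t (ξ, 0)‖ ≤ K * (K * η * ℓ) := by
      refine (hK t _ _ (hfst t (hsub ht)) (hfst a haI)).trans (mul_le_mul_of_nonneg_left ?_ hK0)
      simpa [Prod.norm_def] using hpar t (hsub ht)
    have g3 : ‖F t (ξ, 0) - F τ (ξ, 0)‖ ≤ ν := by
      refine hν t ξ ?_ ((norm_fst_le _).trans (hR a haI))
      rw [abs_of_nonneg (by linarith [ht.1])]; linarith [ht.2]
    have g4 : ‖F t (x t) - F τ (ξ, 0)‖ ≤ K * η * (1 + K * ℓ) + ν := by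
      rw [e]
      refine (norm_add_le _ _).trans ?_
      have := norm_add_le (F t (x t) - F t ((x t).1, 0)) (F t ((x t).1, 0) - F t (ξ, 0))
      nlinarith
    exact (norm_snd_le (F t (x t) - F τ (ξ, 0))).trans g4

/-- Uniform attractivity of a system in the variables `(θ̃, z)`, from a Lyapunov function that
decreases at the rate `‖z‖ ^ 2` and from the excitation of `z` by `θ̃`. -/
lemma isUniformlyGloballyAttractive_of_excitation
    (hLip : IsLipschitzOnBounded F) (h0 : ∀ t, F t 0 = 0) (h1 : ∀ t ξ, (F t (ξ, 0)).1 = 0)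
    (hstab : ∀ R : ℝ, ∃ A : ℝ, ∀ t₀ t : ℝ, t₀ ≤ t → ∀ x : ℝ → P × G,
      IsSolutionOn F (Set.Icc t₀ t) x → ‖x t₀‖ ≤ R → ‖x t‖ ≤ A * ‖x t₀‖)
    (huc : ∀ R, ∀ ν > 0, ∃ h > 0, ∀ (t τ : ℝ) (ξ : P), |t - τ| ≤ h → ‖ξ‖ ≤ R →
      ‖F t (ξ, 0) - F τ (ξ, 0)‖ ≤ ν)
    (hpe : ∃ ℓ > 0, ∃ μ > 0, ∀ (t : ℝ) (ξ : P), ∃ τ ∈ Set.Icc t (t + ℓ),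
      μ * ‖ξ‖ ≤ ‖F τ (ξ, 0)‖)
    (V : ℝ → P × G → ℝ) (hV0 : ∀ t x, 0 ≤ V t x)
    (hVb : ∀ R, ∃ A, ∀ t x, ‖x‖ ≤ R → V t x ≤ A)
    (hV : ∃ k > 0, ∀ (a b : ℝ) (x : ℝ → P × G), IsSolutionOn F (Set.Icc a b) x →
      ∀ t ∈ Set.Icc a b, ∃ w ≤ -k * ‖(x t).2‖ ^ 2,
        HasDerivWithinAt (fun τ => V τ (x τ)) w (Set.Icc a b) t) :
    IsUniformlyGloballyAttractive F := by
  intro r hr σ hσ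
  obtain ⟨ℓ, hℓ, μ, hμ, hpe⟩ := hpe
  obtain ⟨k, hk, hV⟩ := hV
  obtain ⟨A, hA⟩ := hstab r
  obtain ⟨A₁, hA₁⟩ := hstab 1
  set R := |A| * r with hRdef
  have hR0 : 0 ≤ R := by positivity
  have hbound : ∀ t₀ t : ℝ, t₀ ≤ t → ∀ x : ℝ → P × G, IsSolutionOn F (Set.Icc t₀ t) x →
      ‖x t₀‖ ≤ r → ∀ u ∈ Set.Icc t₀ t, ‖x u‖ ≤ R := by
    intro t₀ t _ x hx hx0 u hu
    refine (hA t₀ u hu.1 x (hx.mono (Set.Icc_subset_Icc_right hu.2)) hx0).trans ?_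
    exact mul_le_mul (le_abs_self A) hx0 (norm_nonneg _) (abs_nonneg _)
  -- A state of norm at most `ρ` lies in the unit ball, where the constant `A₁` is valid, and stays
  -- below `σ` ever after.
  set ρ := min 1 (σ / (|A₁| + 1)) with hρdef
  have hρ : 0 < ρ := by positivity
  obtain ⟨K, hK0, hK⟩ := hLip.exists_norm_sub_le R
  obtain ⟨h, hh, hν⟩ := huc R (μ * ρ / 4) (by positivity)
  -- `S` is the coefficient of `η` in `excitation_le_of_quiet` for a window of length ℓ + h. Both
  -- error contributions become at most hμρ / 4, so their sum is below hμρ.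
  set S := 2 + h * (K * (1 + K * (ℓ + h))) with hS
  have hS0 : 0 < S := by positivity
  set η := min (ρ / 2) (h * (μ * ρ / 4) / S) with hηdef
  have hη : 0 < η := by positivity
  have hηS : η * S ≤ h * (μ * ρ / 4) := by
    rw [← le_div_iff₀ hS0]; exact min_le_right _ _
  obtain ⟨W, hW⟩ := hVb r
  obtain ⟨T, hT, hquiet⟩ := exists_quiet_window (G := G) (ℓ := ℓ + h) (η := η) (k := k)
    (L := K * R) (W := W) (by positivity) hη hk (by positivity)
  refine ⟨T, hT, fun t₀ t ht x hx hx0 => ?_⟩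
  have hxR := hbound t₀ t (by linarith) x hx hx0
  have hxT : IsSolutionOn F (Set.Icc t₀ (t₀ + T)) x := hx.mono (Set.Icc_subset_Icc_right ht)
  have hxRT : ∀ u ∈ Set.Icc t₀ (t₀ + T), ‖x u‖ ≤ R :=
    fun u hu => hxR u ⟨hu.1, hu.2.trans ht⟩
  choose! V' hV'1 hV'2 using hV t₀ (t₀ + T) x hxT
  have hzL : ∀ u ∈ Set.Icc t₀ (t₀ + T), ∀ u' ∈ Set.Icc t₀ (t₀ + T), u ≤ u' →
      ‖(x u').2 - (x u).2‖ ≤ K * R * (u' - u) := by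
    intro u hu u' hu' huu'
    have h := (convex_Icc t₀ (t₀ + T)).norm_image_sub_le_of_norm_hasDerivWithin_le hxT
      (C := K * R) (fun v hv => ?_) hu hu'
    · rw [Real.norm_eq_abs, abs_of_nonneg (by linarith)] at h
      exact (norm_snd_le (x u' - x u)).trans h
    · have := hK v (x v) 0 (hxRT v hv) (by simpa using hR0)
      rw [h0, sub_zero, sub_zero] at this
      exact this.trans (mul_le_mul_of_nonneg_left (hxRT v hv) hK0)
  obtain ⟨a, ha, haT, hqa⟩ := hquiet t₀ (fun u => (x u).2) (fun u => V u (x u)) V' hV'2 hV'1 hzL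
    (fun u _ => hV0 _ _) (hW _ _ hx0)
  have hat : a ≤ t := by linarith
  by_cases hxa : ‖x a‖ ≤ ρ
  · have h2 := hA₁ a t hat x (hx.mono (Set.Icc_subset_Icc_left ha)) (hxa.trans (min_le_left _ _))
    have h3 : ρ * (|A₁| + 1) ≤ σ := by
      rw [← le_div_iff₀ (by positivity)]; exact min_le_right _ _
    have h4 : A₁ * ‖x a‖ ≤ (|A₁| + 1) * ρ :=
      mul_le_mul (by linarith [le_abs_self A₁]) hxa (norm_nonneg _) (by positivity)
    linarith
  -- Since η ≤ ρ / 2, a state larger than `ρ` owes its size to the parameter error, which excitation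
  -- then makes visible in `z`.
  · exfalso
    have hsub : Set.Icc a (a + (ℓ + h)) ⊆ Set.Icc t₀ (t₀ + T) := Set.Icc_subset_Icc ha haT
    have hza : ‖(x a).2‖ ≤ η := hqa a ⟨le_rfl, by linarith⟩
    have hξ : ρ < ‖(x a).1‖ := by
      by_contra! hcon
      refine hxa ?_
      rw [Prod.norm_def]
      exact max_le hcon (hza.trans ((min_le_left _ _).trans (by linarith)))
    obtain ⟨τ, hτ, hτμ⟩ := hpe a (x a).1
    have hfin := excitation_le_of_quiet hK0 hh (hxT.mono hsub)
      (fun u hu => hxRT u (hsub hu)) hK h1 (fun u ξ => hν u τ ξ) hqa hτ.1 (by linarith [hτ.2])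
    have h5 : μ * ρ < ‖F τ ((x a).1, 0)‖ := (mul_lt_mul_of_pos_left hξ hμ).trans_le hτμ
    have h6 : h * (μ * ρ) < h * ‖F τ ((x a).1, 0)‖ := mul_lt_mul_of_pos_left h5 hh
    have h7 : 0 < h * (μ * ρ) := by positivity
    have h8 : 2 * η + h * (K * η * (1 + K * (ℓ + h)) + μ * ρ / 4) =
        η * S + h * (μ * ρ / 4) := by rw [hS]; ring
    nlinarith

end Attractivity

/-! ### The closed loop -/

/-- A continuous family of operators that are positive definite is uniformly so on compact sets. -/
lemma exists_coercive_of_isCompact {X E : Type*} [TopologicalSpace X] [NormedAddCommGroup E]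
    [InnerProductSpace ℝ E] [FiniteDimensional ℝ E] {s : Set X} (hs : IsCompact s)
    {A : X → E →L[ℝ] E} (hA : Continuous A) (hpos : ∀ p a, a ≠ 0 → 0 < ⟪a, A p a⟫_ℝ) :
    ∃ d > 0, ∀ p ∈ s, ∀ a, d * ‖a‖ ^ 2 ≤ ⟪a, A p a⟫_ℝ := by
  have hK : IsCompact (s ×ˢ Metric.sphere (0 : E) 1) := hs.prod (isCompact_sphere _ _)
  have hcont : Continuous fun y : X × E => ⟪y.2, A y.1 y.2⟫_ℝ :=
    continuous_snd.inner ((hA.comp continuous_fst).clm_apply continuous_snd)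
  obtain ⟨d, hd, hle⟩ : ∃ d > 0, ∀ y ∈ s ×ˢ Metric.sphere (0 : E) 1, d ≤ ⟪y.2, A y.1 y.2⟫_ℝ := by
    rcases (s ×ˢ Metric.sphere (0 : E) 1).eq_empty_or_nonempty with h | h
    · exact ⟨1, one_pos, by simp [h]⟩
    · obtain ⟨y, hy, hmin⟩ := hK.exists_isMinOn h hcont.continuousOn
      refine ⟨_, hpos y.1 y.2 ?_, fun z hz => hmin hz⟩
      intro h0
      have := hy.2
      simp [h0] at this
  refine ⟨d, hd, fun p hp a => ?_⟩
  rcases eq_or_ne a 0 with rfl | ha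
  · simp
  have hna : ‖a‖ ≠ 0 := norm_ne_zero_iff.2 ha
  have h := hle (p, ‖a‖⁻¹ • a) ⟨hp, by simp [norm_smul, hna]⟩
  simp only [map_smul, inner_smul_left, inner_smul_right, RCLike.conj_to_real] at h
  rw [← mul_assoc, ← sq, inv_pow, inv_mul_eq_div, le_div_iff₀ (by positivity)] at h
  exact h

/-- By Cauchy–Schwarz. It replaces estimates on the inverse of `D`. -/
lemma mul_norm_le_of_coercive {E : Type*} [NormedAddCommGroup E] [InnerProductSpace ℝ E]
    {A : E →L[ℝ] E} {d : ℝ} (h : ∀ a, d * ‖a‖ ^ 2 ≤ ⟪a, A a⟫_ℝ) (a : E) : d * ‖a‖ ≤ ‖A a‖ := by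
  rcases eq_or_ne a 0 with rfl | ha
  · simp
  · have h1 := (h a).trans (real_inner_le_norm a (A a))
    refine le_of_mul_le_mul_left ?_ (norm_pos_iff.2 ha)
    linarith

lemma ContinuousLinearMap.isInvertible_of_inner_pos {E : Type*} [NormedAddCommGroup E]
    [InnerProductSpace ℝ E] [FiniteDimensional ℝ E] {A : E →L[ℝ] E}
    (hpos : ∀ a, a ≠ 0 → 0 < ⟪a, A a⟫_ℝ) : A.IsInvertible := by
  have hinj : Function.Injective A.toLinearMap := by
    rw [← LinearMap.ker_eq_bot, LinearMap.ker_eq_bot']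
    intro a ha
    by_contra hne
    have := hpos a hne
    rw [show A a = 0 from ha, inner_zero_right] at this
    exact lt_irrefl _ this
  exact ⟨(LinearEquiv.ofInjectiveEndo A.toLinearMap hinj).toContinuousLinearEquiv, by ext; rfl⟩

namespace MechanicalModel

/-! ### Linearity in the parameters, the regressor, and smoothness of the vector field -/

section Smooth

variable {n m : ℕ} (M : MechanicalModel n m)

lemma D_apply (θ : EuclideanSpace ℝ (Fin m)) (q : EuclideanSpace ℝ (Fin n)) :
    M.D θ q = ∑ k, θ k • M.inertia k q := Fintype.linearCombination_apply ..

lemma C_apply (θ : EuclideanSpace ℝ (Fin m)) (q v : EuclideanSpace ℝ (Fin n)) :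
    M.C θ q v = ∑ k, θ k • M.coriolis k (q, v) := Fintype.linearCombination_apply ..

lemma g_apply (θ : EuclideanSpace ℝ (Fin m)) (q : EuclideanSpace ℝ (Fin n)) :
    M.g θ q = ∑ k, θ k • M.gravity k q := Fintype.linearCombination_apply ..

lemma D_add (θ θ' : EuclideanSpace ℝ (Fin m)) (q : EuclideanSpace ℝ (Fin n)) :
    M.D (θ + θ') q = M.D θ q + M.D θ' q := by
  simp only [D, WithLp.ofLp_add, map_add]

lemma C_add (θ θ' : EuclideanSpace ℝ (Fin m)) (q v : EuclideanSpace ℝ (Fin n)) :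
    M.C (θ + θ') q v = M.C θ q v + M.C θ' q v := by
  simp only [C, WithLp.ofLp_add, map_add]

lemma g_add (θ θ' : EuclideanSpace ℝ (Fin m)) (q : EuclideanSpace ℝ (Fin n)) :
    M.g (θ + θ') q = M.g θ q + M.g θ' q := by
  simp only [g, WithLp.ofLp_add, map_add]

/-- The force `D(q) a + C(q, v) w + g(q)`, which is `Ψ̃(q, v, w, a)ᵀ θ`. -/
def force (θ : EuclideanSpace ℝ (Fin m)) (q v w a : EuclideanSpace ℝ (Fin n)) :
    EuclideanSpace ℝ (Fin n) :=
  M.D θ q a + M.C θ q v w + M.g θ q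

lemma force_eq_sum (θ : EuclideanSpace ℝ (Fin m)) (q v w a : EuclideanSpace ℝ (Fin n)) :
    M.force θ q v w a = ∑ k, θ k • WithLp.toLp 2 (M.regressor q v w a k) := by
  have : ∀ k, WithLp.toLp 2 (M.regressor q v w a k) =
      M.inertia k q a + M.coriolis k (q, v) w + M.gravity k q := fun k => by ext; rfl
  simp [force, D_apply, C_apply, g_apply, this, smul_add, Finset.sum_add_distrib]

lemma toLp_transpose_regressor_mulVec (θ : EuclideanSpace ℝ (Fin m))
    (q v w a : EuclideanSpace ℝ (Fin n)) :
    WithLp.toLp 2 ((M.regressor q v w a)ᵀ *ᵥ θ.ofLp) = M.force θ q v w a := by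
  rw [force_eq_sum]
  ext i
  simp [Matrix.mulVec, dotProduct, mul_comm]

/-- Transposing the regressor turns the adaptive law's contribution to V̇ into the term sᵀΨ̃ᵀθ̃ that
it has to cancel. -/
lemma inner_regressor_mulVec (θ : EuclideanSpace ℝ (Fin m))
    (q v w a s : EuclideanSpace ℝ (Fin n)) :
    ⟪θ, WithLp.toLp 2 (M.regressor q v w a *ᵥ s.ofLp)⟫_ℝ = ⟪s, M.force θ q v w a⟫_ℝ := by
  rw [← toLp_transpose_regressor_mulVec, EuclideanSpace.inner_eq_star_dotProduct,
    EuclideanSpace.inner_eq_star_dotProduct]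
  simp only [star_trivial]
  rw [Matrix.mulVec_transpose, ← Matrix.dotProduct_mulVec, dotProduct_comm]

variable {X : Type*} [NormedAddCommGroup X] [NormedSpace ℝ X]

lemma contDiff_D {f : X → EuclideanSpace ℝ (Fin m)} {h : X → EuclideanSpace ℝ (Fin n)}
    (hf : ContDiff ℝ ∞ f) (hh : ContDiff ℝ ∞ h) : ContDiff ℝ ∞ fun x => M.D (f x) (h x) := by
  simp only [D_apply]
  exact ContDiff.sum fun k _ => (contDiff_euclidean.1 hf k).smul ((M.inertia_smooth k).comp hh)

lemma contDiff_C {f : X → EuclideanSpace ℝ (Fin m)} {h i : X → EuclideanSpace ℝ (Fin n)}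
    (hf : ContDiff ℝ ∞ f) (hh : ContDiff ℝ ∞ h) (hi : ContDiff ℝ ∞ i) :
    ContDiff ℝ ∞ fun x => M.C (f x) (h x) (i x) := by
  simp only [C_apply]
  exact ContDiff.sum fun k _ =>
    (contDiff_euclidean.1 hf k).smul ((M.coriolis_smooth k).comp (hh.prodMk hi))

lemma contDiff_g {f : X → EuclideanSpace ℝ (Fin m)} {h : X → EuclideanSpace ℝ (Fin n)}
    (hf : ContDiff ℝ ∞ f) (hh : ContDiff ℝ ∞ h) : ContDiff ℝ ∞ fun x => M.g (f x) (h x) := by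
  simp only [g_apply]
  exact ContDiff.sum fun k _ => (contDiff_euclidean.1 hf k).smul ((M.gravity_smooth k).comp hh)

lemma contDiff_speedGradient (γ : ℝ) {q v w a : X → EuclideanSpace ℝ (Fin n)}
    (hq : ContDiff ℝ ∞ q) (hv : ContDiff ℝ ∞ v) (hw : ContDiff ℝ ∞ w) (ha : ContDiff ℝ ∞ a) :
    ContDiff ℝ ∞ fun x => M.speedGradient γ (q x) (v x) (w x) (a x) := by
  unfold speedGradient
  refine ContDiff.neg (ContDiff.const_smul γ (contDiff_euclidean.2 fun k => ?_))
  have h1 : ContDiff ℝ ∞ fun x =>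
      M.inertia k (q x) (a x) + M.coriolis k (q x, v x) (w x) + M.gravity k (q x) :=
    ((((M.inertia_smooth k).comp hq).clm_apply ha).add
      (((M.coriolis_smooth k).comp (hq.prodMk hv)).clm_apply hw)).add
      ((M.gravity_smooth k).comp hq)
  simp only [Matrix.mulVec, dotProduct, regressor, Matrix.of_apply]
  exact ContDiff.sum fun i _ => (contDiff_euclidean.1 h1 i).mul (contDiff_euclidean.1 (hv.sub hw) i)

lemma contDiff_acceleration {θ : EuclideanSpace ℝ (Fin m)} (hM : M.IsEulerLagrange θ)
    {q v u : X → EuclideanSpace ℝ (Fin n)}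
    (hq : ContDiff ℝ ∞ q) (hv : ContDiff ℝ ∞ v) (hu : ContDiff ℝ ∞ u) :
    ContDiff ℝ ∞ fun x => M.acceleration θ (q x) (v x) (u x) := by
  unfold acceleration
  refine ContDiff.clm_apply ?_ ((hu.sub ((M.contDiff_C contDiff_const hq hv).clm_apply hv)).sub
    (M.contDiff_g contDiff_const hq))
  rw [contDiff_iff_contDiffAt]
  intro x
  exact (ContinuousLinearMap.isInvertible_of_inner_pos (hM.posDef (q x))).contDiffAt_map_inverse.comp
    x (M.contDiff_D contDiff_const hq).contDiffAt

/-- The closed-loop vector field as a function of the values `p = (q_d, q̇_d, q̈_d)` of the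
reference trajectory and of the state. -/
def errorField (θ : EuclideanSpace ℝ (Fin m))
    (Kd : EuclideanSpace ℝ (Fin n) →L[ℝ] EuclideanSpace ℝ (Fin n)) (lam γ : ℝ)
    (y : (EuclideanSpace ℝ (Fin n) × EuclideanSpace ℝ (Fin n) × EuclideanSpace ℝ (Fin n)) ×
      EuclideanSpace ℝ (Fin m) × EuclideanSpace ℝ (Fin n) × EuclideanSpace ℝ (Fin n)) :
    EuclideanSpace ℝ (Fin m) × EuclideanSpace ℝ (Fin n) × EuclideanSpace ℝ (Fin n) :=
  let q := y.1.1 + y.2.2.1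
  let vr := y.1.2.1 - lam • y.2.2.1
  let v := vr + y.2.2.2
  let ar := y.1.2.2 - lam • (v - y.1.2.1)
  (M.speedGradient γ q v vr ar, v - y.1.2.1,
    M.acceleration θ q v (M.slotineLiControl Kd (θ + y.2.1) q v vr ar) - ar)

lemma contDiff_errorField {θ : EuclideanSpace ℝ (Fin m)} (hM : M.IsEulerLagrange θ)
    (Kd : EuclideanSpace ℝ (Fin n) →L[ℝ] EuclideanSpace ℝ (Fin n)) (lam γ : ℝ) :
    ContDiff ℝ ∞ (M.errorField θ Kd lam γ) := by
  unfold errorField slotineLiControl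
  refine ContDiff.prodMk (M.contDiff_speedGradient γ ?_ ?_ ?_ ?_) (ContDiff.prodMk ?_
    (ContDiff.sub (M.contDiff_acceleration hM ?_ ?_ (ContDiff.sub (ContDiff.add (ContDiff.add
      (ContDiff.clm_apply (M.contDiff_D ?_ ?_) ?_) (ContDiff.clm_apply (M.contDiff_C ?_ ?_ ?_) ?_))
      (M.contDiff_g ?_ ?_)) ?_)) ?_))
  all_goals fun_prop

end Smooth

end MechanicalModel

lemma ContDiff.deriv_of_two {E : Type*} [NormedAddCommGroup E] [NormedSpace ℝ E] {f : ℝ → E}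
    (hf : ContDiff ℝ 2 f) : ContDiff ℝ 1 (deriv f) := by
  rw [← one_add_one_eq_two, contDiff_succ_iff_deriv] at hf
  exact hf.2.2

namespace MechanicalModel

/-! ### Error dynamics, Lyapunov function and bounds on solutions -/

section ClosedLoop

variable {n m : ℕ} (M : MechanicalModel n m) {θ : EuclideanSpace ℝ (Fin m)}
  {Kd : EuclideanSpace ℝ (Fin n) →L[ℝ] EuclideanSpace ℝ (Fin n)} {lam γ : ℝ}
  {qd : ℝ → EuclideanSpace ℝ (Fin n)}

lemma continuous_closedLoop (hM : M.IsEulerLagrange θ) (hqd : ContDiff ℝ 2 qd) :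
    Continuous (Function.uncurry (M.closedLoop θ Kd lam γ qd)) := by
  have h0 : Continuous qd := hqd.continuous
  have h1 : ContDiff ℝ 1 (deriv qd) := hqd.deriv_of_two
  have h2 : Continuous (deriv (deriv qd)) := h1.continuous_deriv le_rfl
  have h3 : Function.uncurry (M.closedLoop θ Kd lam γ qd) = fun y : ℝ × _ =>
      M.errorField θ Kd lam γ ((qd y.1, deriv qd y.1, deriv (deriv qd) y.1), y.2) := rfl
  rw [h3]
  exact (M.contDiff_errorField hM Kd lam γ).continuous.comp
    (((h0.prodMk (h1.continuous.prodMk h2)).comp continuous_fst).prodMk continuous_snd)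

/-- Time enters the smooth map `errorField` only through the reference values, which stay in a
compact ball; local Lipschitz continuity is therefore uniform in time. The bound on q̈_d is needed
only here. -/
lemma isLipschitzOnBounded_closedLoop (hM : M.IsEulerLagrange θ)
    (hbd : ∃ c : ℝ, ∀ t, ‖qd t‖ ≤ c ∧ ‖deriv qd t‖ ≤ c ∧ ‖deriv (deriv qd) t‖ ≤ c) :
    IsLipschitzOnBounded (M.closedLoop θ Kd lam γ qd) := by
  intro R
  obtain ⟨c, hc⟩ := hbd
  have hloc := ((M.contDiff_errorField hM Kd lam γ).of_le
    (show (1 : WithTop ℕ∞) ≤ ∞ by norm_cast)).locallyLipschitz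
  obtain ⟨K, hK⟩ := (hloc.locallyLipschitzOn (s := Metric.closedBall (0 : EuclideanSpace ℝ (Fin n) ×
      EuclideanSpace ℝ (Fin n) × EuclideanSpace ℝ (Fin n)) c ×ˢ Metric.closedBall 0 R)
      ).exists_lipschitzOnWith_of_compact
    ((isCompact_closedBall _ _).prod (isCompact_closedBall _ _))
  refine ⟨K, fun t => LipschitzOnWith.of_dist_le_mul fun x hx y hy => ?_⟩
  have hp : (qd t, deriv qd t, deriv (deriv qd) t) ∈ Metric.closedBall (0 : EuclideanSpace ℝ (Fin n) ×
      EuclideanSpace ℝ (Fin n) × EuclideanSpace ℝ (Fin n)) c := by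
    rw [mem_closedBall_zero_iff, Prod.norm_def, Prod.norm_def]
    exact max_le (hc t).1 (max_le (hc t).2.1 (hc t).2.2)
  have := hK.dist_le_mul ((qd t, deriv qd t, deriv (deriv qd) t), x) ⟨hp, hx⟩
    ((qd t, deriv qd t, deriv (deriv qd) t), y) ⟨hp, hy⟩
  rwa [dist_prod_same_left] at this

/-- The error dynamics D ṡ + C s + K_d s = Ψ̃ᵀθ̃: by linearity in the parameters the terms with the
true θ cancel, except for the part of the Coriolis force that acts on s. -/
lemma D_acceleration_sub (hM : M.IsEulerLagrange θ) (ξ : EuclideanSpace ℝ (Fin m))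
    (q vr s ar : EuclideanSpace ℝ (Fin n)) :
    M.D θ q (M.acceleration θ q (vr + s)
      (M.slotineLiControl Kd (θ + ξ) q (vr + s) vr ar) - ar) =
      M.force ξ q (vr + s) vr ar - M.C θ q (vr + s) s - Kd s := by
  have hinv := ContinuousLinearMap.isInvertible_of_inner_pos (hM.posDef q)
  rw [map_sub, acceleration, hinv.self_apply_inverse, slotineLiControl, D_add, C_add, g_add, force,
    map_add (M.C θ q (vr + s)) vr s]
  simp only [add_apply, add_sub_cancel_left]
  abel

lemma closedLoop_param_fst (t : ℝ) (ξ : EuclideanSpace ℝ (Fin m)) :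
    (M.closedLoop θ Kd lam γ qd t (ξ, 0)).1 = 0 := by
  simp [closedLoop, speedGradient]

lemma closedLoop_param_snd_fst (t : ℝ) (ξ : EuclideanSpace ℝ (Fin m)) :
    (M.closedLoop θ Kd lam γ qd t (ξ, 0)).2.1 = 0 := by
  simp [closedLoop]

/-- The contribution `Φ(t)ᵀ ξ` of a parameter error `ξ` along the reference. -/
def referenceForce (qd : ℝ → EuclideanSpace ℝ (Fin n)) (ξ : EuclideanSpace ℝ (Fin m)) (t : ℝ) :
    EuclideanSpace ℝ (Fin n) :=
  M.force ξ (qd t) (deriv qd t) (deriv qd t) (deriv (deriv qd) t)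

/-- With q̃ = s = 0 the motion is on the reference, and the Coriolis and damping terms of the error
dynamics vanish. -/
lemma D_closedLoop_param (hM : M.IsEulerLagrange θ) (t : ℝ) (ξ : EuclideanSpace ℝ (Fin m)) :
    M.D θ (qd t) (M.closedLoop θ Kd lam γ qd t (ξ, 0)).2.2 = M.referenceForce qd ξ t := by
  have h := M.D_acceleration_sub (Kd := Kd) hM ξ (qd t) (deriv qd t) 0 (deriv (deriv qd) t)
  simp only [add_zero, map_zero, sub_zero] at h
  simp only [closedLoop, Prod.fst_zero, Prod.snd_zero, smul_zero, add_zero, sub_zero, sub_self,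
    referenceForce]
  exact h

lemma norm_closedLoop_param (t : ℝ) (ξ : EuclideanSpace ℝ (Fin m)) :
    ‖M.closedLoop θ Kd lam γ qd t (ξ, 0)‖ = ‖(M.closedLoop θ Kd lam γ qd t (ξ, 0)).2.2‖ := by
  rw [Prod.norm_def, Prod.norm_def, closedLoop_param_fst, closedLoop_param_snd_fst]
  simp

lemma D_injective (hM : M.IsEulerLagrange θ) (q : EuclideanSpace ℝ (Fin n)) :
    Function.Injective (M.D θ q) :=
  (ContinuousLinearMap.isInvertible_of_inner_pos (hM.posDef q)).injective

lemma closedLoop_zero (hM : M.IsEulerLagrange θ) (t : ℝ) :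
    M.closedLoop θ Kd lam γ qd t 0 = 0 := by
  have h : M.referenceForce qd 0 t = 0 := by
    simp [referenceForce, force, D_apply, C_apply, g_apply]
  refine norm_eq_zero.1 ((M.norm_closedLoop_param t 0).trans (norm_eq_zero.2 ?_))
  refine M.D_injective hM (qd t) ?_
  rw [D_closedLoop_param M hM, h, map_zero]

lemma contDiff_D_self : ContDiff ℝ ∞ (M.D θ) := M.contDiff_D contDiff_const contDiff_id

lemma exists_coercive_D (hM : M.IsEulerLagrange θ) (R : ℝ) :
    ∃ d > 0, ∀ q, ‖q‖ ≤ R → ∀ a, d * ‖a‖ ^ 2 ≤ ⟪a, M.D θ q a⟫_ℝ := by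
  obtain ⟨d, hd, h⟩ := exists_coercive_of_isCompact
    (isCompact_closedBall (0 : EuclideanSpace ℝ (Fin n)) R) M.contDiff_D_self.continuous hM.posDef
  exact ⟨d, hd, fun q hq => h q (by simpa using hq)⟩

lemma exists_norm_D_le (R : ℝ) : ∃ B, 0 ≤ B ∧ ∀ q, ‖q‖ ≤ R → ‖M.D θ q‖ ≤ B := by
  obtain ⟨B, hB⟩ := (isCompact_closedBall (0 : EuclideanSpace ℝ (Fin n)) R).exists_bound_of_continuousOn
    (M.contDiff_D_self (θ := θ)).continuous.continuousOn
  exact ⟨|B|, abs_nonneg _, fun q hq => (hB q (by simpa using hq)).trans (le_abs_self _)⟩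

/-- The Lyapunov function `½ sᵀ D(q) s + |θ̃|² / (2 γ) + c |q̃|²`. -/
def lyapunov (θ : EuclideanSpace ℝ (Fin m)) (γ c : ℝ) (qd : ℝ → EuclideanSpace ℝ (Fin n)) (t : ℝ)
    (x : EuclideanSpace ℝ (Fin m) × EuclideanSpace ℝ (Fin n) × EuclideanSpace ℝ (Fin n)) : ℝ :=
  1 / 2 * ⟪x.2.2, M.D θ (qd t + x.2.1) x.2.2⟫_ℝ + 1 / (2 * γ) * ‖x.1‖ ^ 2 + c * ‖x.2.1‖ ^ 2

lemma inner_D_nonneg (hM : M.IsEulerLagrange θ) (q a : EuclideanSpace ℝ (Fin n)) :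
    0 ≤ ⟪a, M.D θ q a⟫_ℝ := by
  rcases eq_or_ne a 0 with rfl | h
  · simp
  · exact (hM.posDef q a h).le

/-- Symmetry of `D` merges the two terms with ṡ, skew-symmetry cancels sᵀ(½Ḋ − C)s, and the
parameter term cancels the regressor term. What is left is the damping and the contribution of q̃' =
−λq̃ + s. -/
lemma hasDerivWithinAt_lyapunov (hM : M.IsEulerLagrange θ) (hγ : 0 < γ) (c : ℝ)
    (hqd : Differentiable ℝ qd) {a b : ℝ}
    {x : ℝ → EuclideanSpace ℝ (Fin m) × EuclideanSpace ℝ (Fin n) × EuclideanSpace ℝ (Fin n)}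
    (hx : IsSolutionOn (M.closedLoop θ Kd lam γ qd) (Set.Icc a b) x) {t : ℝ}
    (ht : t ∈ Set.Icc a b) :
    HasDerivWithinAt (fun τ => M.lyapunov θ γ c qd τ (x τ))
      (-⟪(x t).2.2, Kd (x t).2.2⟫_ℝ - 2 * c * lam * ‖(x t).2.1‖ ^ 2 +
        2 * c * ⟪(x t).2.1, (x t).2.2⟫_ℝ) (Set.Icc a b) t := by
  set S := Set.Icc a b with hS
  set F := M.closedLoop θ Kd lam γ qd t (x t) with hF
  have hsnd : HasDerivWithinAt (fun t => (x t).2) F.2 S t :=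
    (hx t ht).prodSnd
  have hθ : HasDerivWithinAt (fun t => (x t).1) F.1 S t :=
    (hx t ht).prodFst
  have hq : HasDerivWithinAt (fun t => (x t).2.1) F.2.1 S t :=
    hsnd.prodFst
  have hs : HasDerivWithinAt (fun t => (x t).2.2) F.2.2 S t :=
    hsnd.prodSnd
  set ξ := (x t).1 with hξ
  set e := (x t).2.1 with he
  set s := (x t).2.2 with hsdef
  set q := qd t + e with hqdef
  set vr := deriv qd t - lam • e with hvr
  set ar := deriv (deriv qd) t - lam • (vr + s - deriv qd t) with har
  have hF1 : F.1 = M.speedGradient γ q (vr + s) vr ar := rfl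
  have hF2 : F.2.1 = vr + s - deriv qd t := rfl
  have hF3 : M.D θ q F.2.2 = M.force ξ q (vr + s) vr ar - M.C θ q (vr + s) s - Kd s :=
    M.D_acceleration_sub hM ξ q vr s ar
  have hqt : HasDerivWithinAt (fun τ => qd τ + (x τ).2.1) (vr + s) S t := by
    have h := (hqd t).hasDerivAt.hasDerivWithinAt (s := S) |>.add hq
    rwa [hF2, add_sub_cancel] at h
  have hD : HasDerivWithinAt (fun τ => M.D θ (qd τ + (x τ).2.1)) (fderiv ℝ (M.D θ) q (vr + s)) S t := by
    have hD0 : HasFDerivAt (M.D θ) (fderiv ℝ (M.D θ) q) (qd t + (x t).2.1) :=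
      (M.contDiff_D_self.differentiable (by simp) q).hasFDerivAt
    exact hD0.comp_hasDerivWithinAt t hqt
  have hV := ((((hs.inner ℝ (hD.clm_apply hs)).const_mul (1 / 2)).add
    (hθ.norm_sq.const_mul (1 / (2 * γ)))).add (hq.norm_sq.const_mul c))
  refine hV.congr_deriv ?_
  have hsk := hM.skew q (vr + s) s
  rw [inner_sub_right, inner_smul_right] at hsk
  have hsym : ⟪F.2.2, M.D θ q s⟫_ℝ = ⟪s, M.D θ q F.2.2⟫_ℝ := by
    rw [← hM.symm, real_inner_comm]
  have hgrad : ⟪ξ, F.1⟫_ℝ = -(γ * ⟪s, M.force ξ q (vr + s) vr ar⟫_ℝ) := by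
    rw [hF1, speedGradient, inner_neg_right, inner_smul_right, add_sub_cancel_left,
      inner_regressor_mulVec]
  have hee : ⟪e, F.2.1⟫_ℝ = -(lam * ‖e‖ ^ 2) + ⟪e, s⟫_ℝ := by
    have h : F.2.1 = -(lam • e) + s := by rw [hF2, hvr]; abel
    rw [h, inner_add_right, inner_neg_right, inner_smul_right, real_inner_self_eq_norm_sq]
  rw [inner_add_right, hsym, hF3, inner_sub_right, inner_sub_right, hgrad, hee]
  field_simp
  linarith

/-- The weight c = kλ / 2 lets the cross term be absorbed by the square ½k(λ|q̃| − |s|)². The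
minimum appears because the product carries the maximum norm. -/
lemma inner_bound {k : ℝ} (hk : 0 < k) (hlam : 0 < lam) (e s : EuclideanSpace ℝ (Fin n)) {p : ℝ}
    (hp : k * ‖s‖ ^ 2 ≤ p) :
    -p - 2 * (k * lam / 2) * lam * ‖e‖ ^ 2 + 2 * (k * lam / 2) * ⟪e, s⟫_ℝ ≤
      -(min (k / 2) (k * lam ^ 2 / 2)) * ‖(e, s)‖ ^ 2 := by
  have h1 := real_inner_le_norm e s
  have h2 : k * lam * ⟪e, s⟫_ℝ ≤ k * lam * (‖e‖ * ‖s‖) := by gcongr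
  have h3 : 0 ≤ k * (lam * ‖e‖ - ‖s‖) ^ 2 := by positivity
  have h4 : min (k / 2) (k * lam ^ 2 / 2) * ‖(e, s)‖ ^ 2 ≤
      k / 2 * ‖s‖ ^ 2 + k * lam ^ 2 / 2 * ‖e‖ ^ 2 := by
    rw [Prod.norm_def]
    rcases max_choice ‖e‖ ‖s‖ with h | h <;> simp only [h]
    · have : min (k / 2) (k * lam ^ 2 / 2) * ‖e‖ ^ 2 ≤ k * lam ^ 2 / 2 * ‖e‖ ^ 2 := by
        gcongr; exact min_le_right _ _
      have : 0 ≤ k / 2 * ‖s‖ ^ 2 := by positivity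
      linarith
    · have : min (k / 2) (k * lam ^ 2 / 2) * ‖s‖ ^ 2 ≤ k / 2 * ‖s‖ ^ 2 := by
        gcongr; exact min_le_left _ _
      have : 0 ≤ k * lam ^ 2 / 2 * ‖e‖ ^ 2 := by positivity
      linarith
  nlinarith

/-- The Lyapunov function with a suitable weight decreases at the rate `|(q̃, s)|²`. -/
lemma exists_lyapunov_decrease (hM : M.IsEulerLagrange θ) (hKd : ∀ a, a ≠ 0 → 0 < ⟪a, Kd a⟫_ℝ)
    (hlam : 0 < lam) (hγ : 0 < γ) (hqd : Differentiable ℝ qd) :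
    ∃ c > 0, ∃ k > 0, ∀ (a b : ℝ)
      (x : ℝ → EuclideanSpace ℝ (Fin m) × EuclideanSpace ℝ (Fin n) × EuclideanSpace ℝ (Fin n)),
      IsSolutionOn (M.closedLoop θ Kd lam γ qd) (Set.Icc a b) x → ∀ t ∈ Set.Icc a b,
        ∃ w ≤ -k * ‖(x t).2‖ ^ 2,
          HasDerivWithinAt (fun τ => M.lyapunov θ γ c qd τ (x τ)) w (Set.Icc a b) t := by
  -- A constant family over one point: only compactness of the unit sphere is used.
  obtain ⟨k, hk, hcoer⟩ := exists_coercive_of_isCompact (X := Unit) isCompact_univ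
    (A := fun _ => Kd) continuous_const fun _ => hKd
  refine ⟨k * lam / 2, by positivity, min (k / 2) (k * lam ^ 2 / 2), by positivity,
    fun a b x hx t ht => ⟨_, ?_, M.hasDerivWithinAt_lyapunov hM hγ _ hqd hx ht⟩⟩
  exact inner_bound hk hlam _ _ (hcoer () trivial _)

lemma lyapunov_nonneg (hM : M.IsEulerLagrange θ) (hγ : 0 < γ) {c : ℝ} (hc : 0 ≤ c) (t : ℝ)
    (x : EuclideanSpace ℝ (Fin m) × EuclideanSpace ℝ (Fin n) × EuclideanSpace ℝ (Fin n)) :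
    0 ≤ M.lyapunov θ γ c qd t x := by
  have := M.inner_D_nonneg hM (qd t + x.2.1) x.2.2
  unfold lyapunov
  positivity

lemma exists_lyapunov_le (hγ : 0 < γ) {c : ℝ} (hc : 0 ≤ c) (hbd : ∃ b : ℝ, ∀ t, ‖qd t‖ ≤ b)
    (R : ℝ) : ∃ A, 0 ≤ A ∧ ∀ t x, ‖x‖ ≤ R → M.lyapunov θ γ c qd t x ≤ A * ‖x‖ ^ 2 := by
  obtain ⟨b, hb⟩ := hbd
  obtain ⟨B, hB0, hB⟩ := M.exists_norm_D_le (θ := θ) (b + R)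
  refine ⟨1 / 2 * B + 1 / (2 * γ) + c, by positivity, fun t x hx => ?_⟩
  have h1 : ‖x.1‖ ≤ ‖x‖ := norm_fst_le x
  have h2 : ‖x.2.1‖ ≤ ‖x‖ := (norm_fst_le x.2).trans (norm_snd_le x)
  have h3 : ‖x.2.2‖ ≤ ‖x‖ := (norm_snd_le x.2).trans (norm_snd_le x)
  have h4 : ‖qd t + x.2.1‖ ≤ b + R := (norm_add_le _ _).trans (add_le_add (hb t) (h2.trans hx))
  have h5 : ⟪x.2.2, M.D θ (qd t + x.2.1) x.2.2⟫_ℝ ≤ B * ‖x‖ ^ 2 := by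
    calc _ ≤ ‖x.2.2‖ * ‖M.D θ (qd t + x.2.1) x.2.2‖ := real_inner_le_norm _ _
      _ ≤ ‖x.2.2‖ * (B * ‖x.2.2‖) := by
        gcongr; exact (ContinuousLinearMap.le_opNorm _ _).trans (by gcongr; exact hB _ h4)
      _ = B * ‖x.2.2‖ ^ 2 := by ring
      _ ≤ B * ‖x‖ ^ 2 := by gcongr
  unfold lyapunov
  calc _ ≤ 1 / 2 * (B * ‖x‖ ^ 2) + 1 / (2 * γ) * ‖x‖ ^ 2 + c * ‖x‖ ^ 2 := by gcongr
    _ = _ := by ring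

/-- Linear bounds on solutions, uniform on bounded sets of initial states. -/
lemma exists_norm_solution_le (hM : M.IsEulerLagrange θ) (hKd : ∀ a, a ≠ 0 → 0 < ⟪a, Kd a⟫_ℝ)
    (hlam : 0 < lam) (hγ : 0 < γ) (hqd : Differentiable ℝ qd) (hbd : ∃ b : ℝ, ∀ t, ‖qd t‖ ≤ b)
    (R : ℝ) : ∃ A : ℝ, ∀ t₀ t : ℝ, t₀ ≤ t → ∀ x : ℝ →
      EuclideanSpace ℝ (Fin m) × EuclideanSpace ℝ (Fin n) × EuclideanSpace ℝ (Fin n),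
      IsSolutionOn (M.closedLoop θ Kd lam γ qd) (Set.Icc t₀ t) x → ‖x t₀‖ ≤ R →
        ‖x t‖ ≤ A * ‖x t₀‖ := by
  obtain ⟨c, hc, k, hk, hdec⟩ := M.exists_lyapunov_decrease hM hKd hlam hγ hqd
  obtain ⟨A, hA0, hA⟩ := M.exists_lyapunov_le (θ := θ) hγ hc.le hbd R
  obtain ⟨b, hb⟩ := hbd
  -- `D` is uniformly definite only on bounded sets of q. The term c|q̃|² alone bounds q̃ by √(A /
  -- c) R, so this radius is known before `d` is chosen.
  obtain ⟨d, hd, hcoer⟩ := M.exists_coercive_D hM (b + Real.sqrt (A / c) * R)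
  have hA2 : ∀ κ, 0 < κ → ∀ y z : ℝ, 0 ≤ z → κ * y ^ 2 ≤ A * z ^ 2 → y ≤ Real.sqrt (A / κ) * z := by
    intro κ hκ y z hz h
    refine (le_abs_self y).trans (abs_le_of_sq_le_sq ?_ (by positivity))
    rw [mul_pow, Real.sq_sqrt (by positivity), div_mul_eq_mul_div, le_div_iff₀ hκ]
    linarith
  set A₁ := Real.sqrt (A / (1 / (2 * γ)))
  set A₂ := Real.sqrt (A / c)
  set A₃ := Real.sqrt (A / (1 / 2 * d))
  refine ⟨max A₁ (max A₂ A₃), fun t₀ t ht x hx hx0 => ?_⟩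
  have hx0n := norm_nonneg (x t₀)
  have hle : M.lyapunov θ γ c qd t (x t) ≤ A * ‖x t₀‖ ^ 2 := by
    refine le_trans ?_ (hA t₀ _ hx0)
    have hanti : AntitoneOn (fun τ => M.lyapunov θ γ c qd τ (x τ)) (Set.Icc t₀ t) := by
      choose! w hw hw' using hdec t₀ t x hx
      refine antitoneOn_of_hasDerivWithinAt_nonpos (convex_Icc _ _)
        (fun u hu => (hw' u hu).continuousWithinAt)
        (fun u hu => (hw' u (interior_subset hu)).mono interior_subset) fun u hu => ?_
      exact (hw u (interior_subset hu)).trans (by nlinarith [sq_nonneg ‖(x u).2‖])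
    exact hanti ⟨le_rfl, ht⟩ ⟨ht, le_rfl⟩ ht
  have hin := M.inner_D_nonneg hM (qd t + (x t).2.1) (x t).2.2
  have hp1 : 0 ≤ 1 / (2 * γ) * ‖(x t).1‖ ^ 2 := by positivity
  have hp2 : 0 ≤ c * ‖(x t).2.1‖ ^ 2 := by positivity
  unfold lyapunov at hle
  have h1 : ‖(x t).1‖ ≤ A₁ * ‖x t₀‖ := hA2 _ (by positivity) _ _ hx0n (by linarith)
  have h2 : ‖(x t).2.1‖ ≤ A₂ * ‖x t₀‖ := hA2 _ hc _ _ hx0n (by linarith)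
  have hq : ‖qd t + (x t).2.1‖ ≤ b + A₂ * R :=
    (norm_add_le _ _).trans (add_le_add (hb t) (h2.trans (by gcongr)))
  have h3 : ‖(x t).2.2‖ ≤ A₃ * ‖x t₀‖ := by
    refine hA2 _ (by positivity) _ _ hx0n ?_
    have := hcoer _ hq (x t).2.2
    linarith
  rw [Prod.norm_def, Prod.norm_def]
  refine max_le (h1.trans ?_) (max_le (h2.trans ?_) (h3.trans ?_)) <;> gcongr
  · exact le_max_left _ _
  · exact (le_max_left _ _).trans (le_max_right _ _)
  · exact (le_max_right _ _).trans (le_max_right _ _)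

end ClosedLoop

end MechanicalModel

/-! ### Persistency of excitation and the closed loop -/

lemma integral_mulVec_quadratic {m n : ℕ} {Φ : ℝ → Matrix (Fin m) (Fin n) ℝ}
    (hΦ : ∀ k i, Continuous fun t => Φ t k i) (a b : ℝ) (ξ : Fin m → ℝ) :
    ξ ⬝ᵥ ((Matrix.of fun i j => ∫ τ in a..b, (Φ τ * (Φ τ)ᵀ) i j) *ᵥ ξ) =
      ∫ τ in a..b, ‖WithLp.toLp 2 ((Φ τ)ᵀ *ᵥ ξ)‖ ^ 2 := by
  have hc : ∀ i j, Continuous fun τ => (Φ τ * (Φ τ)ᵀ) i j := by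
    intro i j
    simp only [Matrix.mul_apply, Matrix.transpose_apply]
    exact continuous_finsetSum _ fun k _ => (hΦ i k).mul (hΦ j k)
  have hsq : ∀ τ, ‖WithLp.toLp 2 ((Φ τ)ᵀ *ᵥ ξ)‖ ^ 2 =
      ∑ i, ∑ j, ξ i * ((Φ τ * (Φ τ)ᵀ) i j * ξ j) := by
    intro τ
    have h1 : ‖WithLp.toLp 2 ((Φ τ)ᵀ *ᵥ ξ)‖ ^ 2 = ((Φ τ)ᵀ *ᵥ ξ) ⬝ᵥ ((Φ τ)ᵀ *ᵥ ξ) := by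
      rw [EuclideanSpace.norm_sq_eq]
      simp [dotProduct, sq]
    have h2 : ((Φ τ)ᵀ *ᵥ ξ) ⬝ᵥ ((Φ τ)ᵀ *ᵥ ξ) = ξ ⬝ᵥ ((Φ τ * (Φ τ)ᵀ) *ᵥ ξ) := by
      rw [← Matrix.mulVec_mulVec, Matrix.dotProduct_mulVec ξ, ← Matrix.mulVec_transpose]
    rw [h1, h2]
    simp only [dotProduct, Matrix.mulVec, Finset.mul_sum]
  have hA : ∀ i j, Continuous fun τ => ξ i * ((Φ τ * (Φ τ)ᵀ) i j * ξ j) :=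
    fun i j => continuous_const.mul ((hc i j).mul continuous_const)
  simp only [hsq]
  rw [intervalIntegral.integral_finsetSum fun i _ =>
    (continuous_finsetSum _ fun j _ => hA i j).intervalIntegrable a b]
  simp only [dotProduct, Matrix.mulVec, Matrix.of_apply, Finset.mul_sum]
  refine Finset.sum_congr rfl fun i _ => ?_
  rw [intervalIntegral.integral_finsetSum fun j _ => (hA i j).intervalIntegrable a b]
  simp only [intervalIntegral.integral_const_mul, intervalIntegral.integral_mul_const]

/-- The `μ` of `IsPersistentlyExciting` is a natural number, that on the right is real. Nothing is
lost: lengthening the window raises the lower bound. -/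
lemma isPersistentlyExciting_iff {m n : ℕ} {Φ : ℝ → Matrix (Fin m) (Fin n) ℝ}
    (hΦ : ∀ k i, Continuous fun t => Φ t k i) :
    IsPersistentlyExciting Φ ↔ ∃ T > 0, ∃ μ > 0, ∀ (t : ℝ) (ξ : EuclideanSpace ℝ (Fin m)),
      μ * ‖ξ‖ ^ 2 ≤ ∫ τ in t..(t + T), ‖WithLp.toLp 2 ((Φ τ)ᵀ *ᵥ ξ.ofLp)‖ ^ 2 := by
  have key : ∀ (T μ t : ℝ) (ξ : Fin m → ℝ),
      star ξ ⬝ᵥ (((Matrix.of fun i j => ∫ τ in t..(t + T), (Φ τ * (Φ τ)ᵀ) i j) -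
        μ • (1 : Matrix (Fin m) (Fin m) ℝ)) *ᵥ ξ) =
      (∫ τ in t..(t + T), ‖WithLp.toLp 2 ((Φ τ)ᵀ *ᵥ ξ)‖ ^ 2) - μ * ‖WithLp.toLp 2 ξ‖ ^ 2 := by
    intro T μ t ξ
    rw [star_trivial, Matrix.sub_mulVec, dotProduct_sub, integral_mulVec_quadratic hΦ,
      Matrix.smul_mulVec, Matrix.one_mulVec, dotProduct_smul, EuclideanSpace.norm_sq_eq]
    simp [dotProduct, sq]
  constructor
  · rintro ⟨T, hT, μ, hμ, h⟩
    refine ⟨T, hT, μ, by exact_mod_cast hμ, fun t ξ => ?_⟩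
    have := (h t).dotProduct_mulVec_nonneg ξ.ofLp
    rw [← Nat.cast_smul_eq_nsmul ℝ μ, key] at this
    simpa using sub_nonneg.1 this
  · rintro ⟨T, hT, μ, hμ, h⟩
    have hcont : ∀ ξ : Fin m → ℝ, Continuous fun τ => ‖WithLp.toLp 2 ((Φ τ)ᵀ *ᵥ ξ)‖ ^ 2 := by
      intro ξ
      refine ((PiLp.continuous_toLp 2 _).comp (continuous_pi fun i => ?_)).norm.pow 2
      simp only [Matrix.mulVec, dotProduct, Matrix.transpose_apply]
      exact continuous_finsetSum _ fun k _ => (hΦ k i).mul continuous_const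
    -- Adding up `N` consecutive windows gives the bound Nμ, which exceeds 1 for large `N`; the
    -- natural number 1 is then the witness.
    have hmul : ∀ (N : ℕ) (t : ℝ) (ξ : EuclideanSpace ℝ (Fin m)), N * μ * ‖ξ‖ ^ 2 ≤
        ∫ τ in t..(t + N * T), ‖WithLp.toLp 2 ((Φ τ)ᵀ *ᵥ ξ.ofLp)‖ ^ 2 := by
      intro N t ξ
      induction N with
      | zero => simp
      | succ N ih =>
        rw [← intervalIntegral.integral_add_adjacent_intervals (b := t + N * T)
          ((hcont ξ.ofLp).intervalIntegrable _ _) ((hcont ξ.ofLp).intervalIntegrable _ _)]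
        have h1 := h (t + N * T) ξ
        have h2 : t + N * T + T = t + (N + 1 : ℕ) * T := by push_cast; ring
        rw [h2] at h1
        push_cast at h1 ⊢
        linarith
    obtain ⟨N, hN⟩ := exists_nat_gt (1 / μ)
    have hN0 : (0 : ℝ) < N := lt_trans (by positivity) hN
    rw [div_lt_iff₀ hμ] at hN
    refine ⟨N * T, by positivity, 1, one_pos, fun t => ?_⟩
    rw [← Nat.cast_smul_eq_nsmul ℝ 1]
    refine Matrix.PosSemidef.of_dotProduct_mulVec_nonneg ?_ fun ξ => ?_
    · ext i j
      simp [Matrix.one_apply, Matrix.mul_apply, mul_comm, eq_comm]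
    · rw [key]
      refine sub_nonneg.2 (le_trans ?_ (hmul N t (WithLp.toLp 2 ξ)))
      gcongr
      simpa using hN.le

namespace MechanicalModel

/-! ### The reference regressor as excitation, and the two implications -/

section ClosedLoop

variable {n m : ℕ} (M : MechanicalModel n m) {θ : EuclideanSpace ℝ (Fin m)}
  {Kd : EuclideanSpace ℝ (Fin n) →L[ℝ] EuclideanSpace ℝ (Fin n)} {lam γ : ℝ}
  {qd : ℝ → EuclideanSpace ℝ (Fin n)}

lemma continuous_referenceRegressor (hqd : ContDiff ℝ 2 qd) (k : Fin m) (i : Fin n) :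
    Continuous fun t => M.referenceRegressor qd t k i := by
  have h0 : Continuous qd := hqd.continuous
  have h1 : ContDiff ℝ 1 (deriv qd) := hqd.deriv_of_two
  have h2 : Continuous (deriv (deriv qd)) := h1.continuous_deriv le_rfl
  have h : Continuous fun t => M.inertia k (qd t) (deriv (deriv qd) t) +
      M.coriolis k (qd t, deriv qd t) (deriv qd t) + M.gravity k (qd t) :=
    ((((M.inertia_smooth k).continuous.comp h0).clm_apply h2).add
      (((M.coriolis_smooth k).continuous.comp (h0.prodMk h1.continuous)).clm_apply
        h1.continuous)).add ((M.gravity_smooth k).continuous.comp h0)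
  exact (EuclideanSpace.proj i : EuclideanSpace ℝ (Fin n) →L[ℝ] ℝ).continuous.comp h

lemma isPersistentlyExciting_referenceRegressor_iff (hqd : ContDiff ℝ 2 qd) :
    IsPersistentlyExciting (M.referenceRegressor qd) ↔
      ∃ T > 0, ∃ μ > 0, ∀ (t : ℝ) (ξ : EuclideanSpace ℝ (Fin m)),
        μ * ‖ξ‖ ^ 2 ≤ ∫ τ in t..(t + T), ‖M.referenceForce qd ξ τ‖ ^ 2 := by
  rw [isPersistentlyExciting_iff (M.continuous_referenceRegressor hqd)]
  simp only [referenceRegressor, toLp_transpose_regressor_mulVec]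
  rfl

lemma referenceForce_eq_sum (ξ : EuclideanSpace ℝ (Fin m)) (t : ℝ) :
    M.referenceForce qd ξ t = ∑ k, ξ k • WithLp.toLp 2 (M.referenceRegressor qd t k) :=
  M.force_eq_sum ξ _ _ _ _

lemma continuous_referenceForce (hqd : ContDiff ℝ 2 qd) (ξ : EuclideanSpace ℝ (Fin m)) :
    Continuous (M.referenceForce qd ξ) := by
  have h : M.referenceForce qd ξ =
      fun t => ∑ k, ξ k • WithLp.toLp 2 (M.referenceRegressor qd t k) := by
    funext t; exact M.referenceForce_eq_sum ξ t
  rw [h]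
  refine continuous_finsetSum _ fun k _ => Continuous.const_smul ?_ (ξ k)
  exact (PiLp.continuous_toLp 2 _).comp
    (continuous_pi fun i => M.continuous_referenceRegressor hqd k i)

lemma referenceForce_smul (r : ℝ) (ξ : EuclideanSpace ℝ (Fin m)) (t : ℝ) :
    M.referenceForce qd (r • ξ) t = r • M.referenceForce qd ξ t := by
  simp [referenceForce_eq_sum, Finset.smul_sum, mul_smul]

lemma exists_norm_closedLoop_param_le (hM : M.IsEulerLagrange θ) (hbd : ∃ b : ℝ, ∀ t, ‖qd t‖ ≤ b) :
    ∃ d > 0, ∀ t ξ, d * ‖M.closedLoop θ Kd lam γ qd t (ξ, 0)‖ ≤ ‖M.referenceForce qd ξ t‖ := by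
  obtain ⟨b, hb⟩ := hbd
  obtain ⟨d, hd, h⟩ := M.exists_coercive_D hM b
  refine ⟨d, hd, fun t ξ => ?_⟩
  rw [norm_closedLoop_param, ← M.D_closedLoop_param (Kd := Kd) (lam := lam) (γ := γ) hM]
  exact mul_norm_le_of_coercive (h _ (hb t)) _

lemma uniformContinuous_D_comp (hqd : Differentiable ℝ qd)
    (hbd : ∃ c : ℝ, ∀ t, ‖qd t‖ ≤ c ∧ ‖deriv qd t‖ ≤ c) :
    UniformContinuous fun t => M.D θ (qd t) := by
  obtain ⟨c, hc⟩ := hbd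
  have h1 : UniformContinuous qd := by
    refine (lipschitzWith_of_nnnorm_deriv_le (C := c.toNNReal) hqd fun t => ?_).uniformContinuous
    rw [← NNReal.coe_le_coe, coe_nnnorm]
    exact (hc t).2.trans (Real.le_coe_toNNReal c)
  have h2 := (isCompact_closedBall (0 : EuclideanSpace ℝ (Fin n))
    c).uniformContinuousOn_of_continuous (M.contDiff_D_self (θ := θ)).continuous.continuousOn
  rw [Metric.uniformContinuousOn_iff] at h2
  rw [Metric.uniformContinuous_iff] at h1 ⊢
  intro ε hε
  obtain ⟨δ, hδ, h⟩ := h2 ε hε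
  obtain ⟨δ', hδ', h'⟩ := h1 δ hδ
  exact ⟨δ', hδ', fun {s t} hst => h _ (by simpa using (hc s).1) _ (by simpa using (hc t).1) (h' hst)⟩

lemma exists_referenceForce_sub_le
    (hΦ : ∀ k i, UniformContinuous fun t => M.referenceRegressor qd t k i) (R : ℝ) {ε : ℝ}
    (hε : 0 < ε) : ∃ δ > 0, ∀ (t τ : ℝ) (ξ : EuclideanSpace ℝ (Fin m)), |t - τ| < δ → ‖ξ‖ ≤ R →
      ‖M.referenceForce qd ξ t - M.referenceForce qd ξ τ‖ ≤ ε := by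
  have h1 : UniformContinuous fun t k => WithLp.toLp 2 (M.referenceRegressor qd t k) := by
    refine uniformContinuous_pi.2 fun k => ?_
    exact (PiLp.uniformContinuous_toLp 2 _).comp (uniformContinuous_pi.2 fun i => hΦ k i)
  rw [Metric.uniformContinuous_iff] at h1
  obtain ⟨δ, hδ, h⟩ := h1 (ε / (m * |R| + 1)) (by positivity)
  refine ⟨δ, hδ, fun t τ ξ htτ hξ => ?_⟩
  have h2 := h (a := t) (b := τ) (by rwa [Real.dist_eq])
  have h3 : ∀ k, ‖ξ k • WithLp.toLp 2 (M.referenceRegressor qd t k) -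
      ξ k • WithLp.toLp 2 (M.referenceRegressor qd τ k)‖ ≤ |R| * (ε / (m * |R| + 1)) := by
    intro k
    have h4 : ‖ξ k‖ ≤ |R| := (PiLp.norm_apply_le ξ k).trans (hξ.trans (le_abs_self R))
    have h5 := ((dist_pi_lt_iff (by positivity)).1 h2 k).le
    rw [dist_eq_norm] at h5
    rw [← smul_sub, norm_smul]
    exact mul_le_mul h4 h5 (norm_nonneg _) (abs_nonneg R)
  rw [referenceForce_eq_sum, referenceForce_eq_sum, ← Finset.sum_sub_distrib]
  calc _ ≤ ∑ k : Fin m, |R| * (ε / (m * |R| + 1)) := norm_sum_le_of_le _ fun k _ => h3 k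
    _ = (m * |R|) * (ε / (m * |R| + 1)) := by
        rw [Finset.sum_const, Finset.card_univ, Fintype.card_fin, nsmul_eq_mul]; ring
    _ ≤ ε := by
        rw [mul_div_assoc', div_le_iff₀ (by positivity)]
        nlinarith

/-- The response of the closed loop to a parameter error is uniformly continuous in time. -/
lemma exists_closedLoop_param_sub_le (hM : M.IsEulerLagrange θ) (hqd : Differentiable ℝ qd)
    (hbd : ∃ c : ℝ, ∀ t, ‖qd t‖ ≤ c ∧ ‖deriv qd t‖ ≤ c)
    (hLip : IsLipschitzOnBounded (M.closedLoop θ Kd lam γ qd))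
    (hΦ : ∀ k i, UniformContinuous fun t => M.referenceRegressor qd t k i) (R : ℝ) {ε : ℝ}
    (hε : 0 < ε) : ∃ δ > 0, ∀ (t τ : ℝ) (ξ : EuclideanSpace ℝ (Fin m)), |t - τ| ≤ δ → ‖ξ‖ ≤ R →
      ‖M.closedLoop θ Kd lam γ qd t (ξ, 0) - M.closedLoop θ Kd lam γ qd τ (ξ, 0)‖ ≤ ε := by
  have hD := M.uniformContinuous_D_comp (θ := θ) hqd hbd
  obtain ⟨c, hc⟩ := hbd
  obtain ⟨d, hd, hcoer⟩ := M.exists_coercive_D hM c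
  obtain ⟨K, hK0, hK⟩ := hLip.exists_norm_sub_le R
  rw [Metric.uniformContinuous_iff] at hD
  obtain ⟨δ₁, hδ₁, h₁⟩ := hD (d * ε / 2 / (K * |R| + 1)) (by positivity)
  obtain ⟨δ₂, hδ₂, h₂⟩ := M.exists_referenceForce_sub_le hΦ R (show 0 < d * ε / 2 by positivity)
  -- Halved because the conclusion allows |t − τ| ≤ δ while the moduli of continuity need strict
  -- inequality.
  refine ⟨min δ₁ δ₂ / 2, by positivity, fun t τ ξ htτ hξ => ?_⟩
  have hmin : 0 < min δ₁ δ₂ := lt_min hδ₁ hδ₂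
  have hlt : |t - τ| < min δ₁ δ₂ := by linarith
  have hR : 0 ≤ R := (norm_nonneg _).trans hξ
  set Bt := (M.closedLoop θ Kd lam γ qd t (ξ, 0)).2.2 with hBt
  set Bτ := (M.closedLoop θ Kd lam γ qd τ (ξ, 0)).2.2 with hBτ
  have hnorm : ‖M.closedLoop θ Kd lam γ qd t (ξ, 0) - M.closedLoop θ Kd lam γ qd τ (ξ, 0)‖ =
      ‖Bt - Bτ‖ := by
    rw [Prod.norm_def, Prod.norm_def]
    simp only [Prod.fst_sub, Prod.snd_sub, closedLoop_param_fst, closedLoop_param_snd_fst]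
    simp [hBt, hBτ]
  have hBτn : ‖Bτ‖ ≤ K * R := by
    rw [hBτ, ← norm_closedLoop_param]
    have hn : ‖(ξ, (0 : EuclideanSpace ℝ (Fin n) × EuclideanSpace ℝ (Fin n)))‖ = ‖ξ‖ := by
      simp [Prod.norm_def]
    have := hK τ (ξ, 0) 0 (by rw [hn]; exact hξ) (by simpa using hR)
    rw [M.closedLoop_zero hM, sub_zero, sub_zero, hn] at this
    exact this.trans (by gcongr)
  -- Subtracting the equations D B = Φᵀξ at the two times avoids a continuity estimate for D⁻¹.
  have e1 : M.D θ (qd t) (Bt - Bτ) = (M.referenceForce qd ξ t - M.referenceForce qd ξ τ) -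
      (M.D θ (qd t) - M.D θ (qd τ)) Bτ := by
    rw [map_sub, hBt, M.D_closedLoop_param hM,
      ← M.D_closedLoop_param (Kd := Kd) (lam := lam) (γ := γ) hM τ ξ, sub_apply]
    abel
  have e2 : ‖(M.D θ (qd t) - M.D θ (qd τ)) Bτ‖ ≤ d * ε / 2 := by
    have h3 : ‖M.D θ (qd t) - M.D θ (qd τ)‖ ≤ d * ε / 2 / (K * |R| + 1) := by
      rw [← dist_eq_norm]
      exact (h₁ (by rw [Real.dist_eq]; exact hlt.trans_le (min_le_left _ _))).le
    calc _ ≤ (d * ε / 2 / (K * |R| + 1)) * (K * R) :=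
          (ContinuousLinearMap.le_opNorm _ _).trans (mul_le_mul h3 hBτn (norm_nonneg _) (by positivity))
      _ ≤ d * ε / 2 := by
          rw [abs_of_nonneg hR, div_mul_eq_mul_div, div_le_iff₀ (by positivity)]
          nlinarith [show 0 < d * ε / 2 by positivity]
  have e3 := h₂ t τ ξ (hlt.trans_le (min_le_right _ _)) hξ
  have e4 := mul_norm_le_of_coercive (hcoer _ (hc t).1) (Bt - Bτ)
  have e5 : ‖M.D θ (qd t) (Bt - Bτ)‖ ≤ d * ε := by
    rw [e1]; exact (norm_sub_le _ _).trans (by linarith)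
  rw [hnorm]
  exact le_of_mul_le_mul_left (e4.trans e5) hd

/-- Persistency of excitation in a pointwise form. -/
lemma exists_excitation (hM : M.IsEulerLagrange θ) (hqd : ContDiff ℝ 2 qd)
    (hbd : ∃ b : ℝ, ∀ t, ‖qd t‖ ≤ b)
    (hPE : IsPersistentlyExciting (M.referenceRegressor qd)) :
    ∃ ℓ > 0, ∃ μ > 0, ∀ (t : ℝ) (ξ : EuclideanSpace ℝ (Fin m)), ∃ τ ∈ Set.Icc t (t + ℓ),
      μ * ‖ξ‖ ≤ ‖M.closedLoop θ Kd lam γ qd τ (ξ, 0)‖ := by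
  rw [M.isPersistentlyExciting_referenceRegressor_iff hqd] at hPE
  obtain ⟨T, hT, μ, hμ, h⟩ := hPE
  obtain ⟨b, hb⟩ := hbd
  obtain ⟨B, hB0, hB⟩ := M.exists_norm_D_le (θ := θ) b
  have hs : 0 < Real.sqrt (μ / T) := Real.sqrt_pos.2 (by positivity)
  -- If the response stayed below this multiple of |ξ| on the whole window, |Φᵀξ|² would stay below
  -- μ|ξ|² / T by a fixed margin, against the integral bound. Using B + 1 creates the margin and
  -- covers B = 0.
  refine ⟨T, hT, Real.sqrt (μ / T) / (B + 1), by positivity, fun t ξ => ?_⟩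
  by_contra! hcon
  have hξ : 0 < ‖ξ‖ := by
    have h1 := (norm_nonneg _).trans_lt (hcon t ⟨le_rfl, by linarith⟩)
    exact pos_of_mul_pos_right h1 (by positivity)
  set C := B * (Real.sqrt (μ / T) / (B + 1) * ‖ξ‖) with hC
  have hpt : ∀ τ ∈ Set.Icc t (t + T), ‖M.referenceForce qd ξ τ‖ ^ 2 ≤ C ^ 2 := by
    intro τ hτ
    rw [← M.D_closedLoop_param (Kd := Kd) (lam := lam) (γ := γ) hM]
    have h1 := hcon τ hτ
    rw [norm_closedLoop_param] at h1
    have h2 := (M.D θ (qd τ)).le_opNorm (M.closedLoop θ Kd lam γ qd τ (ξ, 0)).2.2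
    have h3 := h2.trans (mul_le_mul (hB _ (hb τ)) h1.le (norm_nonneg _) hB0)
    gcongr
  have hint : ∫ τ in t..(t + T), ‖M.referenceForce qd ξ τ‖ ^ 2 ≤ T * C ^ 2 := by
    have h1 := intervalIntegral.integral_mono_on (μ := MeasureTheory.volume) (a := t) (b := t + T)
      (by linarith) (((M.continuous_referenceForce hqd ξ).norm.pow 2).intervalIntegrable _ _)
      (intervalIntegrable_const (c := C ^ 2)) hpt
    simpa using h1
  have hCs : C < Real.sqrt (μ / T) * ‖ξ‖ := by
    have : C = (B / (B + 1)) * (Real.sqrt (μ / T) * ‖ξ‖) := by rw [hC]; ring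
    rw [this]
    exact mul_lt_of_lt_one_left (by positivity) ((div_lt_one (by positivity)).2 (by linarith))
  have hC2 : C ^ 2 < μ / T * ‖ξ‖ ^ 2 := by
    have h1 : C ^ 2 < (Real.sqrt (μ / T) * ‖ξ‖) ^ 2 :=
      pow_lt_pow_left₀ hCs (by positivity) two_ne_zero
    rwa [mul_pow (Real.sqrt (μ / T)), Real.sq_sqrt (by positivity)] at h1
  have h4 : T * C ^ 2 < μ * ‖ξ‖ ^ 2 := by
    calc T * C ^ 2 < T * (μ / T * ‖ξ‖ ^ 2) := by gcongr
      _ = μ * ‖ξ‖ ^ 2 := by field_simp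
  exact absurd (h t ξ) (not_le.2 (hint.trans_lt h4))

theorem isPersistentlyExciting_of_isUGAS (hM : M.IsEulerLagrange θ) (hqd : ContDiff ℝ 2 qd)
    (hbd : ∃ b : ℝ, ∀ t, ‖qd t‖ ≤ b)
    (hLip : IsLipschitzOnBounded (M.closedLoop θ Kd lam γ qd))
    (h : IsUGAS (M.closedLoop θ Kd lam γ qd)) :
    IsPersistentlyExciting (M.referenceRegressor qd) := by
  rw [M.isPersistentlyExciting_referenceRegressor_iff hqd]
  obtain ⟨g, -, hg⟩ := h.stable
  obtain ⟨T, hT, hattr⟩ := h.attractive 1 one_pos (1 / 2) one_half_pos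
  -- The ball contains both the solutions starting on the unit sphere and the frozen initial state.
  obtain ⟨K, hK0, hK⟩ := hLip.exists_norm_sub_le (max (g 1) 1)
  obtain ⟨d, hd, hforce⟩ := M.exists_norm_closedLoop_param_le (Kd := Kd) (lam := lam) (γ := γ) hM hbd
  set E := Real.exp (K * T) with hE
  have hE0 : 0 < E := Real.exp_pos _
  -- With this choice EεT = 1/4 uses up half of the displacement 1/2; the integral must account for
  -- the rest, which forces it to be at least ε / (4E).
  set ε := 1 / (4 * E * T) with hε
  have hε0 : 0 < ε := by positivity
  set μ := d ^ 2 * (ε / (4 * E)) with hμ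
  have hunit : ∀ (t : ℝ) (ξ : EuclideanSpace ℝ (Fin m)), ‖ξ‖ = 1 →
      μ ≤ ∫ τ in t..(t + T), ‖M.referenceForce qd ξ τ‖ ^ 2 := by
    intro t ξ hξ
    obtain ⟨x, hx0, hx⟩ := h.forwardComplete t (ξ, 0)
    have hx0n : ‖x t‖ = 1 := by rw [hx0]; simp [Prod.norm_def, hξ]
    have hxT : IsSolutionOn (M.closedLoop θ Kd lam γ qd) (Set.Icc t (t + T)) x :=
      hx.mono Set.Icc_subset_Ici_self
    have hsmall := hattr t (t + T) le_rfl x hxT hx0n.le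
    have hgap : 1 / 2 ≤ ‖x (t + T) - x t‖ := by
      have := norm_sub_norm_le (x t) (x (t + T))
      rw [norm_sub_rev] at this
      linarith
    have hcmp := hxT.norm_sub_init_le (M.continuous_closedLoop hM hqd) (by linarith) hK0 hε0
      fun u hu => hK u _ _ (((hg t u hu.1 x (hxT.mono (Set.Icc_subset_Icc_right hu.2))).trans
        (by rw [hx0n])).trans (le_max_left _ _)) (hx0n.le.trans (le_max_right _ _))
    rw [add_sub_cancel_left, hx0] at hcmp
    rw [hx0] at hgap
    have hI := hgap.trans hcmp
    set I := ∫ τ in t..(t + T), ‖M.closedLoop θ Kd lam γ qd τ (ξ, 0)‖ ^ 2 with hIdef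
    have hIge : ε / (4 * E) ≤ I := by
      have h1 : E * (ε * T) = 1 / 4 := by rw [hε]; field_simp
      rw [mul_add, h1] at hI
      have h2 : 1 / 4 ≤ E * (ε⁻¹ * I) := by linarith
      have h3 : E * (ε⁻¹ * I) = E * I / ε := by field_simp
      rw [h3, le_div_iff₀ hε0] at h2
      rw [div_le_iff₀ (by positivity)]
      linarith
    have hcF : Continuous fun τ => ‖M.closedLoop θ Kd lam γ qd τ (ξ, 0)‖ ^ 2 :=
      (((M.continuous_closedLoop hM hqd).comp (continuous_id.prodMk continuous_const)).norm).pow 2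
    calc μ ≤ d ^ 2 * I := by rw [hμ]; gcongr
      _ = ∫ τ in t..(t + T), d ^ 2 * ‖M.closedLoop θ Kd lam γ qd τ (ξ, 0)‖ ^ 2 :=
        (intervalIntegral.integral_const_mul _ _).symm
      _ ≤ _ := by
        refine intervalIntegral.integral_mono_on (by linarith)
          ((continuous_const.mul hcF).intervalIntegrable _ _)
          (((M.continuous_referenceForce hqd ξ).norm.pow 2).intervalIntegrable _ _) fun τ _ => ?_
        rw [← mul_pow]
        exact pow_le_pow_left₀ (by positivity) (hforce τ ξ) 2
  -- Both sides are homogeneous of degree 2 in ξ, so unit vectors suffice.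
  refine ⟨T, hT, μ, by positivity, fun t ξ => ?_⟩
  rcases eq_or_ne ξ 0 with rfl | hξ
  · simpa using intervalIntegral.integral_nonneg (μ := MeasureTheory.volume)
      (by linarith : t ≤ t + T) fun τ _ => sq_nonneg ‖M.referenceForce qd 0 τ‖
  · have hn : ‖ξ‖ ≠ 0 := norm_ne_zero_iff.2 hξ
    have h1 := hunit t (‖ξ‖⁻¹ • ξ) (by simp [norm_smul, hn])
    simp only [referenceForce_smul, norm_smul, norm_inv, norm_norm, mul_pow, inv_pow,
      intervalIntegral.integral_const_mul] at h1
    rwa [inv_mul_eq_div, le_div_iff₀ (by positivity)] at h1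

theorem isUGAS_of_isPersistentlyExciting (hM : M.IsEulerLagrange θ)
    (hKd : ∀ a, a ≠ 0 → 0 < ⟪a, Kd a⟫_ℝ) (hlam : 0 < lam) (hγ : 0 < γ) (hqd : ContDiff ℝ 2 qd)
    (hbd : ∃ c : ℝ, ∀ t, ‖qd t‖ ≤ c ∧ ‖deriv qd t‖ ≤ c)
    (hLip : IsLipschitzOnBounded (M.closedLoop θ Kd lam γ qd))
    (hΦ : ∀ k i, UniformContinuous fun t => M.referenceRegressor qd t k i)
    (hPE : IsPersistentlyExciting (M.referenceRegressor qd)) :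
    IsUGAS (M.closedLoop θ Kd lam γ qd) := by
  have hdiff : Differentiable ℝ qd := hqd.differentiable (by simp)
  have hbd' : ∃ b : ℝ, ∀ t, ‖qd t‖ ≤ b := hbd.imp fun _ h t => (h t).1
  have hzero : ∀ t, M.closedLoop θ Kd lam γ qd t 0 = 0 := M.closedLoop_zero hM
  have hstab := M.exists_norm_solution_le hM hKd hlam hγ hdiff hbd'
  have hUGS : IsUGS (M.closedLoop θ Kd lam γ qd) := IsUGS.of_linear_bounds hstab
  obtain ⟨c, hc, hdec⟩ := M.exists_lyapunov_decrease hM hKd hlam hγ hdiff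
  refine ⟨hUGS.isForwardComplete hLip (M.continuous_closedLoop hM hqd) hzero, hUGS, ?_⟩
  refine isUniformlyGloballyAttractive_of_excitation hLip hzero M.closedLoop_param_fst hstab
    (fun R ε hε => M.exists_closedLoop_param_sub_le hM hdiff hbd hLip hΦ R hε)
    (M.exists_excitation hM hqd hbd' hPE) (M.lyapunov θ γ c qd)
    (M.lyapunov_nonneg hM hγ hc.le) (fun R => ?_) hdec
  obtain ⟨A, hA0, hA⟩ := M.exists_lyapunov_le (θ := θ) hγ hc.le hbd' R
  refine ⟨A * R ^ 2, fun t x hx => (hA t x hx).trans ?_⟩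
  gcongr

end ClosedLoop

end MechanicalModel

end

theorem mainTheorem11 {n m : ℕ} (M : MechanicalModel n m)
    (θ : EuclideanSpace ℝ (Fin m)) (hM : M.IsEulerLagrange θ)
    (Kd : EuclideanSpace ℝ (Fin n) →L[ℝ] EuclideanSpace ℝ (Fin n))
    (hKd : ∀ a, a ≠ 0 → 0 < ⟪a, Kd a⟫_ℝ)
    (lam γ : ℝ) (hlam : 0 < lam) (hγ : 0 < γ)
    (qd : ℝ → EuclideanSpace ℝ (Fin n)) (hqd : ContDiff ℝ 2 qd)
    (hbd : ∃ c : ℝ, ∀ t, ‖qd t‖ ≤ c ∧ ‖deriv qd t‖ ≤ c ∧ ‖deriv (deriv qd) t‖ ≤ c) :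
    (IsUGAS (M.closedLoop θ Kd lam γ qd) → IsPersistentlyExciting (M.referenceRegressor qd)) ∧
    ((∀ k i, UniformContinuous fun t => M.referenceRegressor qd t k i) →
      IsPersistentlyExciting (M.referenceRegressor qd) →
        IsUGAS (M.closedLoop θ Kd lam γ qd)) := by
  have hLip := M.isLipschitzOnBounded_closedLoop (Kd := Kd) (lam := lam) (γ := γ) hM hbd
  exact ⟨M.isPersistentlyExciting_of_isUGAS hM hqd (hbd.imp fun _ h t => (h t).1) hLip,
    M.isUGAS_of_isPersistentlyExciting hM hKd hlam hγ hqd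
      (hbd.imp fun _ h t => ⟨(h t).1, (h t).2.1⟩) hLip⟩
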